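/- Let $L$ be a countable first-order language and let $M$ be a countably infinite $L$-structure that is $\omega$-categorical (all countably infinite models of $\mathrm{Th}(M)$ are isomorphic) and $MS$-measurable. The latter means that there is a function $h=(\dim,\mathrm{meas})$, assigning to each subset of some $M^n$ that is definable with parameters a value in $\mathbb N\times\mathbb R_{\ge 0}$, such that: * $\mathrm{meas}(X)>0$ for every nonempty definable $X$; * for each $L$-formula $\varphi(x,y)$ the set $\{h(\varphi(M,b)) : b\in M^{|y|}\}$ is finite, and for each value $(d,r)$ the set $\{b : h(\varphi(M,b))=(d,r)\}$ is $\emptyset$-definable; * $h(X)=(0,|X|)$ for every finite $X$; * (Fubini) if $f:X\to Y$ is a definable surjection between definable sets, then the set $D=\{h(f^{-1}(y)) : y\in Y\}$ is finite, $Y_p=\{y\in Y : h(f^{-1}(y))=p\}$ is definable for each $p=(d_p,r_p)\in D$, $\dim X=\max_{p\in D}(d_p+\dim Y_p)$, and $\mathrm{meas}(X)=\sum r_p\,\mathrm{meas}(Y_p)$, summed over those $p\in D$ for which the maximum is attained (for $X=Y=\emptyset$, the maximum and the sum are read as $0$). Let $\mathbb M$ be an elementary extension of $M$ that is $\kappa$-saturated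 and strongly $\kappa$-homogeneous for some infinite cardinal $\kappa$ (for instance a monster model, or $\mathbb M=M$ with $\kappa=\aleph_0$). For a finite tuple of variables $x$, let $\mathrm{Def}_x(\mathbb M)$ be the Boolean algebra of $L(\mathbb M)$-formulas in $x$ up to equivalence in $\mathbb M$. For $A\subseteq\mathbb M$ let: * $F(A)\subseteq\mathrm{Def}_x(\mathbb M)$ be the set of formulas that fork over $A$, i.e. that imply a finite disjunction of formulas with parameters in $\mathbb M$ each of which divides over $A$. Here $\psi(x,c)$ divides over $A$ if for some $k\in\mathbb N$ there is a sequence $(c_i)_{i<\omega}$ of realizations of $\mathrm{tp}(c/A)$ in $\mathbb M$ such that $\{\psi(x,c_i) : i<\omega\}$ is $k$-inconsistent; * $\mathcal O(A)\subseteq\mathrm{Def}_x(\mathbb M)$ be the set of formulas that are universally measure zero over $A$, i.e. satisfy $\mu(\varphi(x,b))=0$ for every $\mathrm{Aut}(\mathbb M/A)$-invariant Keisler measure (finitely additive probability measure) $\mu$ on $\mathrm{Def}_x(\mathbb M)$. Then, for every finite $A\subseteq M$ and every finite tuple of variables $x$, $F(A)=\mathcal O(A)$. -/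

import Mathlib

open FirstOrder

universe u v w w'

namespace MSForking

section Basic

variable {L : FirstOrder.Language.{u, v}} {N : Type w} [L.Structure N]

/-- The subset `φ(N, b)` of `N ^ n` defined by the formula `φ(x, b)`, where `φ(x, y)` is an
`L`-formula with `x` an `n`-tuple and `y` an `m`-tuple of variables. -/
def solutionSet {n m : ℕ} (φ : L.Formula (Fin n ⊕ Fin m)) (b : Fin m → N) : Set (Fin n → N) :=
  {x | φ.Realize (Sum.elim x b)}

theorem definable_solutionSet {n m : ℕ} (φ : L.Formula (Fin n ⊕ Fin m)) (b : Fin m → N) :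
    (Set.univ : Set N).Definable L (solutionSet φ b) := by
  rw [Set.definable_iff_exists_formula_sum]
  refine ⟨φ.relabel (Sum.elim Sum.inr fun i => Sum.inl ⟨b i, Set.mem_univ _⟩), ?_⟩
  ext x
  simp only [solutionSet, Set.mem_ofPred_eq, FirstOrder.Language.Formula.realize_relabel]
  refine iff_of_eq (congrArg φ.Realize ?_)
  funext i
  rcases i with i | i <;> rfl

end Basic

/-- The Boolean algebra `Def_x(N)`, for `x` an `n`-tuple of variables, of `L(N)`-formulas in `x` up
to equivalence, i.e. of the subsets of `N ^ n` that are definable with parameters from `N`. -/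
abbrev Def (L : FirstOrder.Language.{u, v}) (N : Type w) [L.Structure N] (n : ℕ) : Type w :=
  L.DefinableSet (Set.univ : Set N) (Fin n)

/-- The class of the `L(N)`-formula `φ(x, b)` in `Def_x(N)`. -/
def formulaClass {L : FirstOrder.Language.{u, v}} {N : Type w} [L.Structure N] {n m : ℕ}
    (φ : L.Formula (Fin n ⊕ Fin m)) (b : Fin m → N) : Def L N n :=
  ⟨solutionSet φ b, definable_solutionSet φ b⟩

/-- `a ≡_A b`: the tuples `a` and `b` have the same type over `A`. -/
def SameTypeOver (L : FirstOrder.Language.{u, v}) {N : Type w} [L.Structure N] (A : Set N) {m : ℕ}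
    (a b : Fin m → N) : Prop :=
  ∀ φ : L[[A]].Formula (Fin m), φ.Realize a ↔ φ.Realize b

/-! ### Categoricity, saturation and homogeneity -/

/-- `M` is the countable model of an `ω`-categorical theory: `M` is countably infinite and all
countably infinite models of its complete theory are isomorphic. -/
def IsOmegaCategorical (L : FirstOrder.Language.{u, v}) (M : Type w) [L.Structure M] : Prop :=
  Countable M ∧ Infinite M ∧
    Cardinal.Categorical (Cardinal.aleph0 : Cardinal.{w}) (L.completeTheory M)

/-- `N` is `κ`-saturated: every finitely satisfiable set of formulas in one variable with
parameters from a set of size less than `κ` is realized. -/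
def IsSaturated (L : FirstOrder.Language.{u, v}) (N : Type w) [L.Structure N]
    (κ : Cardinal.{w}) : Prop :=
  ∀ B : Set N, Cardinal.mk B < κ → ∀ Γ : Set (L[[B]].Formula (Fin 1)),
    (∀ Γ₀ : Finset (L[[B]].Formula (Fin 1)), (Γ₀ : Set (L[[B]].Formula (Fin 1))) ⊆ Γ →
      ∃ x : Fin 1 → N, ∀ φ ∈ Γ₀, φ.Realize x) →
    ∃ x : Fin 1 → N, ∀ φ ∈ Γ, φ.Realize x

/-- `N` is strongly `κ`-homogeneous: every partial elementary map of `N` defined on a set of size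
less than `κ` extends to an automorphism. -/
def IsStronglyHomogeneous (L : FirstOrder.Language.{u, v}) (N : Type w) [L.Structure N]
    (κ : Cardinal.{w}) : Prop :=
  ∀ (B : Set N) (f : B → N), Cardinal.mk B < κ →
    (∀ φ : L.Formula B, φ.Realize (fun b : B => (b : N)) ↔ φ.Realize f) →
    ∃ σ : N ≃[L] N, ∀ b : B, σ b = f b

/-! ### Forking -/

/-- The formula `φ(x, b)` divides over `A`: for some `k` there is a sequence `(s i)` of realizations
of `tp(b/A)` such that `{φ(x, s i) : i < ω}` is `k`-inconsistent. -/
def Divides {L : FirstOrder.Language.{u, v}} {N : Type w} [L.Structure N] (A : Set N) {n m : ℕ}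
    (φ : L.Formula (Fin n ⊕ Fin m)) (b : Fin m → N) : Prop :=
  ∃ (k : ℕ) (s : ℕ → Fin m → N), (∀ i, SameTypeOver L A (s i) b) ∧
    ∀ I : Finset ℕ, I.card = k → ¬ ∃ x : Fin n → N, ∀ i ∈ I, x ∈ solutionSet φ (s i)

/-- An element of `Def_x(N)` forks over `A` if it implies a finite disjunction of formulas
`ψ_i(x, c_i)`, with parameters in `N`, each of which divides over `A`. -/
def Forks {L : FirstOrder.Language.{u, v}} {N : Type w} [L.Structure N] (A : Set N) {n : ℕ}
    (X : Def L N n) : Prop :=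
  ∃ (r : ℕ) (m : Fin r → ℕ) (ψ : ∀ i, L.Formula (Fin n ⊕ Fin (m i))) (c : ∀ i, Fin (m i) → N),
    (∀ i, Divides A (ψ i) (c i)) ∧ (X : Set (Fin n → N)) ⊆ ⋃ i, solutionSet (ψ i) (c i)

/-- `F(A)`: the set of formulas, in the variable `x` of length `n`, that fork over `A`. -/
def forkingIdeal (L : FirstOrder.Language.{u, v}) {N : Type w} [L.Structure N] (A : Set N)
    (n : ℕ) : Set (Def L N n) :=
  {X | Forks A X}

/-! ### Keisler measures -/

/-- `μ : Def_x(N) → [0, 1]` is a Keisler measure: a finitely additive probability measure. -/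
structure IsKeislerMeasure {L : FirstOrder.Language.{u, v}} {N : Type w} [L.Structure N] {n : ℕ}
    (μ : Def L N n → ℝ) : Prop where
  nonneg : ∀ X, 0 ≤ μ X
  map_top : μ ⊤ = 1
  map_sup : ∀ X Y, Disjoint X Y → μ (X ⊔ Y) = μ X + μ Y

/-- `μ` is `Aut(N/A)`-invariant: `μ(φ(x, σ b)) = μ(φ(x, b))` for each automorphism `σ` of `N` that
fixes `A` pointwise. -/
def IsInvariantOver {L : FirstOrder.Language.{u, v}} {N : Type w} [L.Structure N] (A : Set N)
    {n : ℕ} (μ : Def L N n → ℝ) : Prop :=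
  ∀ σ : N ≃[L] N, (∀ a ∈ A, σ a = a) →
    ∀ (m : ℕ) (φ : L.Formula (Fin n ⊕ Fin m)) (b : Fin m → N),
      μ (formulaClass φ (fun i => σ (b i))) = μ (formulaClass φ b)

/-- `O(A)`: the set of formulas, in the variable `x` of length `n`, that are universally measure
zero over `A`, i.e. have measure zero for every `Aut(N/A)`-invariant Keisler measure. -/
def universallyNullIdeal (L : FirstOrder.Language.{u, v}) {N : Type w} [L.Structure N] (A : Set N)
    (n : ℕ) : Set (Def L N n) :=
  {X | ∀ μ : Def L N n → ℝ, IsKeislerMeasure μ → IsInvariantOver A μ → μ X = 0}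

/-! ### `MS`-measurable structures -/

/-- `dim` and `meas` form a dimension-measure function `h = (dim, meas)` on the sets definable in
`M` with parameters (the values on other sets are irrelevant). -/
structure IsDimensionMeasure (L : FirstOrder.Language.{u, v}) (M : Type w) [L.Structure M]
    (dim : ∀ n : ℕ, Set (Fin n → M) → ℕ) (meas : ∀ n : ℕ, Set (Fin n → M) → ℝ) : Prop where
  /-- The measure of a nonempty definable set is strictly positive. -/
  pos : ∀ (n : ℕ) (X : Set (Fin n → M)), (Set.univ : Set M).Definable L X → X.Nonempty →
    0 < meas n X
  /-- Each formula `φ(x, y)` yields finitely many values `h(φ(M, b))`. -/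
  finite_values : ∀ (n m : ℕ) (φ : L.Formula (Fin n ⊕ Fin m)),
    (Set.range fun b : Fin m → M =>
      (dim n (solutionSet φ b), meas n (solutionSet φ b))).Finite
  /-- A finite set (possibly empty) has dimension `0` and its cardinality as measure. -/
  finite_sets : ∀ (n : ℕ) (X : Set (Fin n → M)), X.Finite →
    dim n X = 0 ∧ meas n X = (X.ncard : ℝ)
  /-- Each value is taken on a `∅`-definable set of parameters. -/
  definable : ∀ (n m : ℕ) (φ : L.Formula (Fin n ⊕ Fin m)) (d : ℕ) (r : ℝ),
    (∅ : Set M).Definable L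
      {b : Fin m → M | dim n (solutionSet φ b) = d ∧ meas n (solutionSet φ b) = r}
  /-- Fubini: let `f : X → Y` be a definable surjection between definable sets. Then the fibres take
  finitely many values `p = (d_p, r_p)` of `h`, each on a definable subset `Y_p` of `Y`; the
  dimension of `X` is the maximum of the `d_p + dim Y_p`, and the measure of `X` is the sum of the
  `r_p * meas Y_p` over those `p` for which the maximum is attained. -/
  fubini : ∀ (m n : ℕ) (X : Set (Fin m → M)) (Y : Set (Fin n → M))
    (f : (Fin m → M) → (Fin n → M)),
    (Set.univ : Set M).Definable L X → (Set.univ : Set M).Definable L Y →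
    (Set.univ : Set M).Definable L
      {v : Fin m ⊕ Fin n → M | v ∘ Sum.inl ∈ X ∧ v ∘ Sum.inr = f (v ∘ Sum.inl)} →
    f '' X = Y →
    ∃ (D : Finset (ℕ × ℝ)) (part : ℕ × ℝ → Set (Fin n → M)),
      (∀ p, part p =
        {y ∈ Y | dim m {x ∈ X | f x = y} = p.1 ∧ meas m {x ∈ X | f x = y} = p.2}) ∧
      (∀ p ∈ D, (part p).Nonempty ∧ (Set.univ : Set M).Definable L (part p)) ∧
      Y = ⋃ p ∈ D, part p ∧
      dim m X = D.sup (fun p => p.1 + dim n (part p)) ∧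
      meas m X = ∑ p ∈ D with p.1 + dim n (part p) = dim m X, p.2 * meas n (part p)

/-- `M` is `MS`-measurable: it is infinite and admits a dimension-measure function. -/
def IsMSMeasurable (L : FirstOrder.Language.{u, v}) (M : Type w) [L.Structure M] : Prop :=
  Infinite M ∧ ∃ (dim : ∀ n : ℕ, Set (Fin n → M) → ℕ) (meas : ∀ n : ℕ, Set (Fin n → M) → ℝ),
    IsDimensionMeasure L M dim meas

end MSForking

/-! Forking implies null. If φ(x, b) divides over a, its conjugates along the k-inconsistent
sequence all have the same measure under an invariant μ. Sets no k of which meet have total measure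
at most k (`sum_measure_le`), however many there are, so this common measure is 0; finite unions and
subsets of null sets are null.

Null implies forking. Let φ(x, b) be null over a. By ω-categoricity some b' in M has the type of b
over a, and this type is isolated; let Q be its solution set in M. Let P_d be the set of x whose
dual set {y ∈ Q : φ(x, y)} is nonempty of dimension d. It is definable over a, and finitely many P_d
cover φ(M, b'). The relative measure in P_d induces an invariant Keisler measure on the extension,
by copying parameters into M (`exists_keislerMeasure`). Hence φ(M, b') ∩ P_d, unless empty, has
smaller dimension than P_d, and so has every conjugate.

Counting the dimension of the incidence relation between P_d and Q in two ways now gives d < dim Q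
(`dim_section_lt`). A second double count shows that, for definable Y ⊆ P_d, the y for which φ(x, y)
meets Y without lowering its dimension form a set of dimension at most d (`dim_notDrop_le`).
Finitely many such sets do not cover Q. So a sequence in Q can be chosen greedily, each term
lowering the dimension of every intersection of earlier sets or emptying it, and no dim P_d + 1
terms are consistent (`exists_inconsistent_sequence`). Thus φ(x, b) implies a finite disjunction of
formulas that divide. -/

namespace MSForking

open FirstOrder.Language Set

/-! ### Types of tuples and isolation -/

section Types

variable {L : FirstOrder.Language.{u, v}} {M : Type w} {N : Type w'} [L.Structure M] [L.Structure N]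

/-- Equality of the complete types of two tuples, possibly in different structures. -/
def SameType (L : FirstOrder.Language.{u, v}) {M : Type w} {N : Type w'} [L.Structure M]
    [L.Structure N] {α : Type*} (a : α → M) (b : α → N) : Prop :=
  ∀ φ : L.Formula α, φ.Realize a ↔ φ.Realize b

theorem SameType.symm {α : Type*} {a : α → M} {b : α → N} (h : SameType L a b) :
    SameType L b a := fun φ => (h φ).symm

theorem SameType.trans {α : Type*} {K : Type*} [L.Structure K] {a : α → M} {b : α → N} {c : α → K}
    (h : SameType L a b) (h' : SameType L b c) : SameType L a c := fun φ => (h φ).trans (h' φ)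

theorem SameType.comp {α β : Type*} {a : α → M} {b : α → N} (h : SameType L a b) (f : β → α) :
    SameType L (a ∘ f) (b ∘ f) := fun φ => by
  simpa [Formula.realize_relabel] using h (φ.relabel f)

theorem sameType_elementaryEmbedding (j : M ↪ₑ[L] N) {α : Type*} (a : α → M) :
    SameType L (fun i => j (a i)) a := fun φ => j.map_formula φ a

theorem sameType_equiv (j : M ≃[L] N) {α : Type*} (a : α → M) :
    SameType L (fun i => j (a i)) a := sameType_elementaryEmbedding j.toElementaryEmbedding a

theorem realize_congr_freeVarFinset {α : Type*} [DecidableEq α] {φ : L.Formula α} {v w : α → M}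
    (h : ∀ a ∈ φ.freeVarFinset, v a = w a) : φ.Realize v ↔ φ.Realize w := by
  have h1 := BoundedFormula.realize_restrictFreeVar (φ := φ) (f := id) (v := fun a => v a)
    (xs := (default : Fin 0 → M)) v (fun _ => rfl)
  have h2 := BoundedFormula.realize_restrictFreeVar (φ := φ) (f := id) (v := fun a => v a)
    (xs := (default : Fin 0 → M)) w (fun a => h a a.2)
  exact h1.symm.trans h2

/-- The complete type of the tuple `d` is isolated by a formula. -/
def IsIsolated (L : FirstOrder.Language.{u, v}) {M : Type w} [L.Structure M] {α : Type*}
    (d : α → M) : Prop :=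
  ∃ Θ : L.Formula α, Θ.Realize d ∧ ∀ y : α → M, Θ.Realize y → SameType L y d

/-- The image of a set defined by a formula under restriction to finitely many coordinates is
defined by a formula. -/
theorem exists_formula_image_comp {α : Type*} [Finite α] (θ : L.Formula ℕ) (f : α → ℕ) :
    ∃ Θ : L.Formula α, ∀ y : α → M, Θ.Realize y ↔ ∃ v : ℕ → M, θ.Realize v ∧ v ∘ f = y := by
  classical
  rcases isEmpty_or_nonempty M with hM | ⟨⟨m₀⟩⟩
  · exact ⟨⊥, fun y => by simp⟩
  have := Fintype.ofFinite α
  -- Only the variables of `θ` and those in the range of `f` matter, which reduces the claim to a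
  -- projection between finite powers. Coordinates outside `s` are later filled with `m₀`.
  let s : Finset ℕ := θ.freeVarFinset ∪ Finset.univ.image f
  let θ' : L.Formula s := θ.restrictFreeVar fun i => ⟨i, Finset.mem_union_left _ i.2⟩
  have hθ' : ∀ v : ℕ → M, θ'.Realize (fun i : s => v i) ↔ θ.Realize v := fun v =>
    BoundedFormula.realize_restrictFreeVar v fun _ => rfl
  let f' : α → s := fun i =>
    ⟨f i, Finset.mem_union_right _ (Finset.mem_image_of_mem f (Finset.mem_univ i))⟩
  have hdef : (∅ : Set M).Definable L (Set.ofPred θ'.Realize) := empty_definable_iff.2 ⟨θ', rfl⟩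
  obtain ⟨Θ, hΘ⟩ := empty_definable_iff.1 (hdef.image_comp f')
  refine ⟨Θ, fun y => ?_⟩
  have : Θ.Realize y ↔ y ∈ (fun g : s → M => g ∘ f') '' (Set.ofPred θ'.Realize) := by rw [hΘ]; rfl
  rw [this]
  constructor
  · rintro ⟨g, hg, rfl⟩
    refine ⟨fun i => if h : i ∈ s then g ⟨i, h⟩ else m₀, (hθ' _).1 ?_, ?_⟩
    · simpa using hg
    · funext i
      have : f i ∈ s := (f' i).2
      simp [this, f']
  · rintro ⟨v, hv, rfl⟩
    exact ⟨fun i => v i, (hθ' v).2 hv, rfl⟩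

end Types

/-! ### Omitting types by a generic sequence -/

section Omitting

variable {L : FirstOrder.Language.{u, v}} {M : Type w} [L.Structure M]

/-- The formulas in variables indexed by `ℕ` that are satisfiable in `M`, ordered by reverse
implication. -/
def ForcingCondition (L : FirstOrder.Language.{u, v}) (M : Type w) [L.Structure M] : Type max u v :=
  {θ : L.Formula ℕ // ∃ v : ℕ → M, θ.Realize v}

/-- Stronger conditions are larger, so generic sets of conditions are ideals. -/
instance : Preorder (ForcingCondition L M) :=
  Preorder.lift fun θ => (OrderDual.toDual (Set.ofPred θ.1.Realize : Set (ℕ → M)))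

theorem ForcingCondition.le_iff {θ η : ForcingCondition L M} :
    θ ≤ η ↔ ∀ v : ℕ → M, η.1.Realize v → θ.1.Realize v := Iff.rfl

/-- A countable family of dense sets of satisfiable formulas is met by the formulas true of some
sequence in some structure elementarily equivalent to `M`. -/
theorem exists_generic_sequence [Nonempty M] {ι : Type*} [Countable ι] (D : ι → Set (L.Formula ℕ))
    (hD : ∀ i (θ : L.Formula ℕ) (v : ℕ → M), θ.Realize v →
      ∃ η ∈ D i, (∃ v : ℕ → M, η.Realize v) ∧ ∀ v : ℕ → M, η.Realize v → θ.Realize v) :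
    ∃ (N : Type max u v) (_ : L.Structure N) (c : ℕ → N), (N ≅[L] M) ∧
      ∀ i, ∃ η ∈ D i, η.Realize c := by
  classical
  have := Encodable.ofCountable ι
  let 𝒟 : ι → Order.Cofinal (ForcingCondition L M) := fun i =>
    ⟨{θ | θ.1 ∈ D i}, fun θ => by
      obtain ⟨v, hv⟩ := θ.2
      obtain ⟨η, hη, hs, hle⟩ := hD i θ.1 v hv
      exact ⟨⟨η, hs⟩, hη, hle⟩⟩
  let v₀ : ℕ → M := fun _ => Classical.arbitrary M
  let p₀ : ForcingCondition L M := ⟨⊤, v₀, by simp⟩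
  let G := Order.idealOfCofinals p₀ 𝒟
  let T : L[[ℕ]].Theory := (L.lhomWithConstants ℕ).onTheory (L.completeTheory M) ∪
    ⋃ θ : G, {Formula.equivSentence θ.1.1}
  -- Since `G` is directed, a single condition in it implies any finite part of `T`; a solution of
  -- that condition then turns `M` into a model of this part.
  have hfin : ∀ s : Finset L[[ℕ]].Sentence, (s : Set L[[ℕ]].Sentence) ⊆ T →
      ∃ θ : G, ∀ v : ℕ → M, θ.1.1.Realize v →
        ∀ φ ∈ s, @Sentence.Realize _ M (@withConstantsStructure L M _ ℕ (constantsOn.structure v))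
          φ := by
    intro s
    induction s using Finset.induction_on with
    | empty => exact fun _ => ⟨⟨p₀, Order.mem_idealOfCofinals _ _⟩, fun v _ φ h => by simp at h⟩
    | insert φ s hφ ih =>
      intro hs
      rw [Finset.coe_insert, Set.insert_subset_iff] at hs
      obtain ⟨θ, hθ⟩ := ih hs.2
      rcases hs.1 with h | h
      · refine ⟨θ, fun v hv ψ hψ => ?_⟩
        rcases Finset.mem_insert.1 hψ with rfl | hψ
        · obtain ⟨χ, hχ, rfl⟩ := h
          let := constantsOn.structure v
          exact (LHom.realize_onSentence M (L.lhomWithConstants ℕ) χ).2 hχ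
        · exact hθ v hv ψ hψ
      · obtain ⟨η, hη⟩ := Set.mem_iUnion.1 h
        obtain ⟨ζ, hζG, h1, h2⟩ := G.directed' θ.1 θ.2 η.1 η.2
        refine ⟨⟨ζ, hζG⟩, fun v hv ψ hψ => ?_⟩
        rcases Finset.mem_insert.1 hψ with rfl | hψ
        · rw [Set.mem_singleton_iff.1 hη]
          let := constantsOn.structure v
          exact (Formula.realize_equivSentence M η.1.1).2 (ForcingCondition.le_iff.1 h2 v hv)
        · exact hθ v (ForcingCondition.le_iff.1 h1 v hv) ψ hψ
  have hsat : T.IsSatisfiable := by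
    rw [Theory.isSatisfiable_iff_isFinitelySatisfiable]
    intro s hs
    obtain ⟨θ, hθ⟩ := hfin s hs
    obtain ⟨v, hv⟩ := θ.1.2
    let := constantsOn.structure v
    have : M ⊨ (s : L[[ℕ]].Theory) := ⟨fun {φ} h => hθ v hv φ h⟩
    exact Theory.Model.isSatisfiable M
  obtain ⟨K⟩ := hsat
  let : L.Structure K := (L.lhomWithConstants ℕ).reduct K
  have : (L.lhomWithConstants ℕ).IsExpansionOn K := LHom.isExpansionOn_reduct _ _
  have hK : K ⊨ L.completeTheory M := by
    rw [← LHom.onTheory_model (L.lhomWithConstants ℕ)]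
    exact K.is_model.mono Set.subset_union_left
  refine ⟨K, inferInstance, fun i => (L.con i : K), ?_, fun i => ?_⟩
  · rw [elementarilyEquivalent_iff]
    intro φ
    exact (realize_iff_of_model_completeTheory M K φ)
  · obtain ⟨θ, hθ, hG⟩ := Order.cofinal_meets_idealOfCofinals p₀ 𝒟 i
    refine ⟨θ.1, hθ, (Formula.realize_equivSentence K θ.1).1 ?_⟩
    exact K.is_model.realize_of_mem _
      (Or.inr (Set.mem_iUnion.2 ⟨⟨θ, hG⟩, Set.mem_singleton _⟩))

theorem countable_formula [Countable L.Symbols] (α : Type*) [Countable α] :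
    Countable (L.Formula α) := by
  have h := BoundedFormula.card_le (L := L) (α := α)
  have h' : Cardinal.mk (Σ n, L.BoundedFormula α n) ≤ Cardinal.aleph0 := by
    refine h.trans (max_le le_rfl (Cardinal.add_le_aleph0.2 ⟨?_, ?_⟩))
    · exact Cardinal.lift_le_aleph0.2 (Cardinal.mk_le_aleph0_iff.2 inferInstance)
    · exact Cardinal.lift_le_aleph0.2 (Cardinal.mk_le_aleph0_iff.2 ‹_›)
  have := Cardinal.mk_le_aleph0_iff.1 h'
  exact (sigma_mk_injective (i := 0) : Function.Injective
    (fun φ : L.BoundedFormula α 0 => (⟨0, φ⟩ : Σ n, L.BoundedFormula α n))).countable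

/-- **Omitting types**: a type that is realized but not isolated in `M` is omitted in a countable
structure elementarily equivalent to `M`. -/
theorem exists_countable_omitting [Countable L.Symbols] {m : ℕ} (d : Fin m → M)
    [Nonempty M] (hd : ¬ IsIsolated L d) :
    ∃ (N : Type max u v) (_ : L.Structure N), Countable N ∧ (N ≅[L] M) ∧
      ∀ y : Fin m → N, ¬ SameType L y d := by
  classical
  have := countable_formula (L := L) (ℕ ⊕ Fin 1)
  -- The first family provides Henkin witnesses: either `ψ` has no solution or a term of the
  -- sequence is one. The second makes each tuple of terms satisfy some formula that fails at `d`.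
  let D : (L.Formula (ℕ ⊕ Fin 1) ⊕ (Fin m → ℕ)) → Set (L.Formula ℕ) := Sum.elim
    (fun ψ => {η | (∃ θ, η = θ ⊓ (ψ.iExs (Fin 1)).not) ∨
      ∃ θ, ∃ j : ℕ, η = θ ⊓ ψ.relabel (Sum.elim id fun _ => j)})
    (fun f => {η | ∃ θ, ∃ χ : L.Formula (Fin m), ¬ χ.Realize d ∧ η = θ ⊓ χ.relabel f})
  obtain ⟨N, hN, c, hNM, hc⟩ := exists_generic_sequence (M := M) D (by
    rintro (ψ | f) θ v hv
    · by_cases hx : ∃ x : Fin 1 → M, ψ.Realize (Sum.elim v x)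
      · obtain ⟨x, hx⟩ := hx
        -- The variable `j` is fresh for `θ` and `ψ`, so its value may be reset to the witness.
        obtain ⟨j, hj⟩ := Infinite.exists_notMem_finset
          (θ.freeVarFinset ∪ ψ.freeVarFinset.toLeft)
        rw [Finset.mem_union, not_or] at hj
        refine ⟨θ ⊓ ψ.relabel (Sum.elim id fun _ => j), Or.inr ⟨θ, j, rfl⟩,
          ⟨Function.update v j (x 0), ?_⟩, fun v h => (Formula.realize_inf.1 h).1⟩
        rw [Formula.realize_inf, Formula.realize_relabel]
        refine ⟨(realize_congr_freeVarFinset fun a ha => ?_).2 hv,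
          (realize_congr_freeVarFinset ?_).2 hx⟩
        · exact Function.update_of_ne (by rintro rfl; exact hj.1 ha) _ _
        · rintro (a | a) ha
          · have haj : a ≠ j := fun h => hj.2 (h ▸ Finset.mem_toLeft.2 ha)
            exact Function.update_of_ne haj _ _
          · simp [Subsingleton.elim a 0]
      · refine ⟨θ ⊓ (ψ.iExs (Fin 1)).not, Or.inl ⟨θ, rfl⟩, ⟨v, ?_⟩,
          fun v h => (Formula.realize_inf.1 h).1⟩
        rw [Formula.realize_inf, Formula.realize_not, Formula.realize_iExs]
        exact ⟨hv, hx⟩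
    -- Density uses non-isolation: if every solution of `θ` had the type of `d` on the coordinates
    -- `f`, the projection `Θ` of `θ` would isolate that type.
    · obtain ⟨Θ, hΘ⟩ := exists_formula_image_comp (M := M) θ f
      have : ∃ w : ℕ → M, θ.Realize w ∧ ¬ SameType L (w ∘ f) d := by
        by_contra! hcon
        refine hd ⟨Θ, (hcon v hv Θ).1 ((hΘ _).2 ⟨v, hv, rfl⟩), fun y hy => ?_⟩
        obtain ⟨w, hw, rfl⟩ := (hΘ y).1 hy
        exact hcon w hw
      obtain ⟨w, hw, hwd⟩ := this
      obtain ⟨χ, hχd, hχ⟩ : ∃ χ : L.Formula (Fin m), ¬ χ.Realize d ∧ χ.Realize (w ∘ f) := by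
        obtain ⟨χ, hχ⟩ := not_forall.1 hwd
        by_cases h : χ.Realize d
        · exact ⟨χ.not, by simpa using h, by simpa [h] using hχ⟩
        · exact ⟨χ, h, by simpa [h] using hχ⟩
      refine ⟨θ ⊓ χ.relabel f, ⟨θ, χ, hχd, rfl⟩, ⟨w, ?_⟩,
        fun v h => (Formula.realize_inf.1 h).1⟩
      rw [Formula.realize_inf, Formula.realize_relabel]
      exact ⟨hw, hχ⟩)
  -- The Henkin witnesses give the Tarski–Vaught criterion, so the range of `c` is an elementary
  -- substructure.
  have hmeets : L.MeetsDefinable (Set.range c) := by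
    rintro E ⟨x, hx⟩ hE
    obtain ⟨φ, hφ⟩ := definable_iff_exists_formula_sum.1 hE
    let g : Set.range c → ℕ := fun a => a.2.choose
    have hg : ∀ a, c (g a) = a := fun a => a.2.choose_spec
    let ψ : L.Formula (ℕ ⊕ Fin 1) := φ.relabel (Sum.map g id)
    have hψ : ∀ y : Fin 1 → N, ψ.Realize (Sum.elim c y) ↔ y 0 ∈ E := by
      intro y
      have : y 0 ∈ E ↔ y ∈ {v : Fin 1 → N | φ.Realize (Sum.elim (↑) v)} := by rw [← hφ]; rfl
      rw [this, Formula.realize_relabel]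
      refine iff_of_eq (congrArg φ.Realize ?_)
      funext i
      rcases i with i | i
      · exact hg i
      · rfl
    obtain ⟨η, (⟨θ, rfl⟩ | ⟨θ, j, rfl⟩), hη⟩ := hc (Sum.inl ψ)
    · rw [Formula.realize_inf, Formula.realize_not, Formula.realize_iExs] at hη
      exact (hη.2 ⟨fun _ => x, (hψ _).2 hx⟩).elim
    · rw [Formula.realize_inf, Formula.realize_relabel] at hη
      refine ⟨c j, (hψ fun _ => c j).1 ?_, j, rfl⟩
      convert hη.2 using 1
      funext i
      rcases i with i | i <;> rfl
  let S := hmeets.toElementarySubstructure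
  have hS : ∀ x, x ∈ S ↔ x ∈ Set.range c := fun x => by
    change x ∈ Substructure.closure L (Set.range c) ↔ _
    rw [← SetLike.mem_coe, hmeets.closure_eq_self]
  refine ⟨S, inferInstance, ?_, ?_, fun y hy => ?_⟩
  · have : Countable (Set.range c) := (Set.countable_range c).to_subtype
    exact (Equiv.subtypeEquivRight hS).countable_iff.2 this
  · exact S.elementarilyEquivalent.trans hNM
  · choose f hf using fun i => (hS (y i)).1 (y i).2
    obtain ⟨η, ⟨θ, χ, hχ, rfl⟩, hη⟩ := hc (Sum.inr f)
    rw [Formula.realize_inf, Formula.realize_relabel] at hη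
    refine hχ ((hy χ).1 ((S.subtype.map_formula χ y).1 ?_))
    convert hη.2 using 1
    funext i
    exact (hf i).symm

end Omitting

/-! ### Consequences of ω-categoricity -/

section Categorical

variable {L : FirstOrder.Language.{u, v}} {M : Type w} [L.Structure M]

/-- Categoricity compares only models in the universe of `M`, so the structure of `N` is first
copied onto a lift of `ℕ` to that universe. -/
theorem IsOmegaCategorical.nonempty_equiv (hM : IsOmegaCategorical L M) {N : Type*} [L.Structure N]
    [Countable N] (h : N ≅[L] M) : Nonempty (N ≃[L] M) := by
  obtain ⟨hcM, hiM, hcat⟩ := hM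
  have : Infinite N := h.infinite_iff.2 hiM
  obtain ⟨e⟩ : Nonempty (N ≃ ULift.{w} ℕ) :=
    ⟨(nonempty_equiv_of_countable (α := N) (β := ℕ)).some.trans Equiv.ulift.symm⟩
  let : L.Structure (ULift.{w} ℕ) := e.inducedStructure
  let E : N ≃[L] ULift.{w} ℕ := e.inducedStructureEquiv
  have hU : ULift.{w} ℕ ≅[L] M := E.symm.toElementaryEmbedding.elementarilyEquivalent.trans h
  have : ULift.{w} ℕ ⊨ L.completeTheory M := by
    rw [← hU.completeTheory_eq]
    infer_instance
  obtain ⟨F⟩ := hcat (Theory.ModelType.of _ (ULift.{w} ℕ)) (Theory.ModelType.of _ M)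
    (by simp) (Cardinal.mk_eq_aleph0 M)
  exact ⟨Equiv.comp F E⟩

/-- Part of the **Ryll-Nardzewski theorem**: the types realized in the countable model of an
`ω`-categorical theory are isolated. -/
theorem IsOmegaCategorical.isIsolated [Countable L.Symbols] (hM : IsOmegaCategorical L M) {m : ℕ}
    (d : Fin m → M) : IsIsolated L d := by
  have : Infinite M := hM.2.1
  by_contra hd
  obtain ⟨N, _, _, hNM, hN⟩ := exists_countable_omitting d hd
  obtain ⟨e⟩ := hM.nonempty_equiv hNM
  exact hN (fun i => e.symm (d i)) (sameType_equiv e.symm d)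

theorem IsOmegaCategorical.isIsolated_of_finite [Countable L.Symbols] (hM : IsOmegaCategorical L M)
    {α : Type*} [Finite α] (d : α → M) : IsIsolated L d := by
  obtain ⟨k, ⟨e⟩⟩ := Finite.exists_equiv_fin α
  obtain ⟨Θ, h1, h2⟩ := hM.isIsolated (d ∘ e.symm)
  refine ⟨Θ.relabel e.symm, by simpa using h1, fun y hy => ?_⟩
  have := (h2 (y ∘ e.symm) (by simpa using hy)).comp e
  simpa [Function.comp_assoc] using this

/-- Homogeneity of an `ω`-categorical structure. -/
theorem IsOmegaCategorical.exists_sameType_extension [Countable L.Symbols]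
    (hM : IsOmegaCategorical L M) {α β : Type*} [Finite α] [Finite β] (a a' : β → M)
    (h : SameType L a a') (b : α → M) :
    ∃ b' : α → M, SameType L (Sum.elim b a) (Sum.elim b' a') := by
  obtain ⟨Θ, h1, h2⟩ := hM.isIsolated_of_finite (Sum.elim b a)
  -- The solvability of `Θ` over `a` is part of the type of `a`, hence holds over `a'`.
  have := (h ((Θ.relabel Sum.swap).iExs α)).1 (by
    rw [Formula.realize_iExs]
    exact ⟨b, by simpa [Formula.realize_relabel] using h1⟩)
  rw [Formula.realize_iExs] at this
  obtain ⟨b', hb'⟩ := this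
  exact ⟨b', (h2 _ (by simpa [Formula.realize_relabel] using hb')).symm⟩

/-- Every finite tuple of an elementary extension of an `ω`-categorical structure `M` has, over
finitely many elements of `M`, the type of a tuple of `M`. -/
theorem IsOmegaCategorical.exists_sameType [Countable L.Symbols] (hM : IsOmegaCategorical L M)
    {N : Type w'} [L.Structure N] (j : M ↪ₑ[L] N) {α β : Type} [Finite α] [Finite β] (a : β → M)
    (b : α → N) : ∃ b' : α → M, SameType L (Sum.elim b (fun i => j (a i))) (Sum.elim b' a) := by
  have hiM : Infinite M := hM.2.1
  have : Infinite N := Infinite.of_injective j j.injective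
  -- A countable elementary substructure containing all the elements involved is isomorphic to `M`;
  -- homogeneity of `M` then moves the image of `a` back to `a`.
  obtain ⟨S, hS, hScard⟩ := exists_elementarySubstructure_card_eq L
    (Set.range (Sum.elim b (fun i => j (a i)))) (Cardinal.aleph0.{0}) le_rfl
    (by
      rw [Cardinal.lift_aleph0, Cardinal.lift_le_aleph0]
      exact (Set.countable_range _).le_aleph0)
    (by
      rw [Cardinal.lift_aleph0, Cardinal.lift_le_aleph0]
      exact Cardinal.mk_le_aleph0_iff.2 ‹_›)
    (by
      rw [Cardinal.lift_aleph0, Cardinal.aleph0_le_lift]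
      exact Cardinal.aleph0_le_mk N)
  have : Countable S := by
    rw [← Cardinal.mk_le_aleph0_iff, ← Cardinal.lift_le_aleph0.{_, 0}]
    exact hScard.trans_le (by simp)
  obtain ⟨e⟩ := hM.nonempty_equiv (S.elementarilyEquivalent.trans j.elementarilyEquivalent.symm)
  let t : α ⊕ β → S := fun i => ⟨_, hS (Set.mem_range_self i)⟩
  have ht : SameType L (Sum.elim b fun i => j (a i)) (fun i => e (t i)) :=
    (sameType_elementaryEmbedding S.subtype t).trans (sameType_equiv e t).symm
  obtain ⟨b', hb'⟩ := hM.exists_sameType_extension (fun i => e (t (Sum.inr i))) a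
    ((ht.comp Sum.inr).symm.trans (sameType_elementaryEmbedding j a))
    (fun i => e (t (Sum.inl i)))
  refine ⟨b', ht.trans ?_⟩
  convert hb' using 1
  funext i
  rcases i with i | i <;> rfl

end Categorical

/-! ### Definable graphs -/

section Definability

variable {L : FirstOrder.Language.{u, v}} {M : Type w} [L.Structure M] {A : Set M}

theorem definable_eq_coord {α : Type*} (i k : α) : A.Definable L {v : α → M | v i = v k} :=
  ⟨(Term.var i).equal (Term.var k), by ext; simp⟩

theorem definable_eq_const {α : Type*} (i : α) (c : M) :
    (univ : Set M).Definable L {v : α → M | v i = c} :=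
  ⟨(Term.var i).equal (L.con (⟨c, mem_univ c⟩ : (univ : Set M))).term, by ext; simp⟩

/-- The graph of `f` on the definable set `X` is definable. -/
def DefinableGraphOn (L : FirstOrder.Language.{u, v}) {M : Type w} [L.Structure M] {m n : ℕ}
    (X : Set (Fin m → M)) (f : (Fin m → M) → (Fin n → M)) : Prop :=
  (univ : Set M).Definable L
    {v : Fin m ⊕ Fin n → M | v ∘ Sum.inl ∈ X ∧ v ∘ Sum.inr = f (v ∘ Sum.inl)}

theorem DefinableGraphOn.definable_image {m n : ℕ} {X : Set (Fin m → M)}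
    {f : (Fin m → M) → (Fin n → M)} (h : DefinableGraphOn L X f) :
    (univ : Set M).Definable L (f '' X) := by
  convert h.image_comp (Sum.inr : Fin n → Fin m ⊕ Fin n) using 1
  ext y
  constructor
  · rintro ⟨x, hx, rfl⟩
    exact ⟨Sum.elim x (f x), ⟨hx, rfl⟩, rfl⟩
  · rintro ⟨v, ⟨h1, h2⟩, rfl⟩
    exact ⟨_, h1, h2.symm⟩

theorem definableGraphOn_comp {m n : ℕ} {X : Set (Fin m → M)} (hX : (univ : Set M).Definable L X)
    (g : Fin n → Fin m) : DefinableGraphOn L X (fun v => v ∘ g) := by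
  have h : (univ : Set M).Definable L (⋂ i ∈ (Finset.univ : Finset (Fin n)),
      {v : Fin m ⊕ Fin n → M | v (Sum.inr i) = v (Sum.inl (g i))}) :=
    definable_biInter_finset (fun i => definable_eq_coord _ _) _
  unfold DefinableGraphOn
  convert (hX.preimage_comp (Sum.inl : Fin m → Fin m ⊕ Fin n)).inter h using 1
  ext v
  simp [funext_iff]

end Definability

/-! ### Additivity and monotonicity of dimension and measure -/

namespace IsDimensionMeasure

variable {L : FirstOrder.Language.{u, v}} {M : Type w} [L.Structure M]
  {dim : ∀ n : ℕ, Set (Fin n → M) → ℕ} {meas : ∀ n : ℕ, Set (Fin n → M) → ℝ}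

theorem dim_empty (H : IsDimensionMeasure L M dim meas) (n : ℕ) : dim n ∅ = 0 :=
  (H.finite_sets n ∅ finite_empty).1

theorem meas_empty (H : IsDimensionMeasure L M dim meas) (n : ℕ) : meas n ∅ = 0 := by
  simpa using (H.finite_sets n ∅ finite_empty).2

theorem fubini_image (H : IsDimensionMeasure L M dim meas) {m n : ℕ} {X : Set (Fin m → M)}
    {f : (Fin m → M) → (Fin n → M)} (hX : (univ : Set M).Definable L X)
    (hf : DefinableGraphOn L X f) :
    ∃ (D : Finset (ℕ × ℝ)) (part : ℕ × ℝ → Set (Fin n → M)),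
      (∀ p, part p = {y ∈ f '' X |
        dim m {x ∈ X | f x = y} = p.1 ∧ meas m {x ∈ X | f x = y} = p.2}) ∧
      (∀ p ∈ D, (part p).Nonempty ∧ (univ : Set M).Definable L (part p)) ∧
      (∀ y ∈ f '' X, (dim m {x ∈ X | f x = y}, meas m {x ∈ X | f x = y}) ∈ D) ∧
      dim m X = D.sup (fun p => p.1 + dim n (part p)) ∧
      meas m X = ∑ p ∈ D with p.1 + dim n (part p) = dim m X, p.2 * meas n (part p) := by
  obtain ⟨D, part, h1, h2, h3, h4, h5⟩ :=
    H.fubini m n X (f '' X) f hX hf.definable_image hf rfl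
  refine ⟨D, part, h1, h2, fun y hy => ?_, h4, h5⟩
  rw [h3] at hy
  obtain ⟨p, hp, hy⟩ := mem_iUnion₂.1 hy
  rw [h1] at hy
  rwa [hy.2.1, hy.2.2]

/-- `h` is invariant under definable bijections. -/
theorem image_of_injOn (H : IsDimensionMeasure L M dim meas) {m n : ℕ} {X : Set (Fin m → M)}
    {f : (Fin m → M) → (Fin n → M)} (hX : (univ : Set M).Definable L X)
    (hf : DefinableGraphOn L X f) (hinj : InjOn f X) :
    dim m X = dim n (f '' X) ∧ meas m X = meas n (f '' X) := by
  rcases X.eq_empty_or_nonempty with rfl | hne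
  · simp [H.dim_empty, H.meas_empty]
  obtain ⟨D, part, h1, h2, h3, h4, h5⟩ := H.fubini_image hX hf
  have hfib : ∀ y ∈ f '' X, dim m {x ∈ X | f x = y} = 0 ∧ meas m {x ∈ X | f x = y} = 1 := by
    rintro _ ⟨x, hx, rfl⟩
    have : {x' ∈ X | f x' = f x} = {x} := by
      ext x'
      exact ⟨fun h => hinj h.1 hx h.2, fun h => by rw [mem_singleton_iff.1 h]; exact ⟨hx, rfl⟩⟩
    rw [this]
    simpa using H.finite_sets m {x} (finite_singleton x)
  have hD : D = {(0, 1)} := by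
    ext p
    rw [Finset.mem_singleton]
    constructor
    · intro hp
      obtain ⟨y, hy⟩ := (h2 p hp).1
      rw [h1] at hy
      have := hfib y hy.1
      exact Prod.ext (hy.2.1.symm.trans this.1) (hy.2.2.symm.trans this.2)
    · rintro rfl
      obtain ⟨x, hx⟩ := hne
      have := h3 (f x) (mem_image_of_mem f hx)
      rwa [(hfib _ (mem_image_of_mem f hx)).1, (hfib _ (mem_image_of_mem f hx)).2] at this
  have hpart : part (0, 1) = f '' X := by
    rw [h1]
    exact sep_eq_self_iff_mem_true.2 hfib
  subst hD
  have h4' : dim m X = dim n (f '' X) := by simpa [hpart] using h4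
  refine ⟨h4', ?_⟩
  simpa [Finset.filter_singleton, hpart, h4'] using h5

/-- Additivity is not an axiom: it is Fubini for the map sending `X` to one point and `Y` to
another. -/
theorem union_of_disjoint [Infinite M] (H : IsDimensionMeasure L M dim meas) {m : ℕ}
    {X Y : Set (Fin m → M)} (hX : (univ : Set M).Definable L X)
    (hY : (univ : Set M).Definable L Y) (hXY : Disjoint X Y) :
    dim m (X ∪ Y) = max (dim m X) (dim m Y) ∧
    meas m (X ∪ Y) = (if dim m X = max (dim m X) (dim m Y) then meas m X else 0) +
      (if dim m Y = max (dim m X) (dim m Y) then meas m Y else 0) := by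
  classical
  rcases X.eq_empty_or_nonempty with rfl | hXne
  · simp [H.dim_empty, H.meas_empty]
  rcases Y.eq_empty_or_nonempty with rfl | hYne
  · simp [H.dim_empty, H.meas_empty]
  obtain ⟨c₀, c₁, hc⟩ := exists_pair_ne M
  let f : (Fin m → M) → (Fin 1 → M) := fun x _ => if x ∈ X then c₀ else c₁
  have hYX : ∀ y ∈ Y, y ∉ X := fun y hy hx => disjoint_left.1 hXY hx hy
  have hfX : ∀ x ∈ X, f x = fun _ => c₀ := fun x hx => by simp [f, hx]
  have hfY : ∀ x ∈ Y, f x = fun _ => c₁ := fun x hx => by simp [f, hYX x hx]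
  have hc' : (fun _ : Fin 1 => c₀) ≠ fun _ => c₁ := fun h => hc (congrFun h 0)
  have hf : DefinableGraphOn L (X ∪ Y) f := by
    unfold DefinableGraphOn
    convert ((hX.preimage_comp (Sum.inl : Fin m → Fin m ⊕ Fin 1)).inter
      (definable_eq_const (Sum.inr 0) c₀)).union
      ((hY.preimage_comp (Sum.inl : Fin m → Fin m ⊕ Fin 1)).inter
      (definable_eq_const (Sum.inr 0) c₁)) using 1
    ext v
    have hv : ∀ c : M, v ∘ Sum.inr = (fun _ : Fin 1 => c) ↔ v (Sum.inr 0) = c := fun c =>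
      ⟨fun h => congrFun h 0, fun h => funext fun i => by rw [Subsingleton.elim i 0]; exact h⟩
    simp only [mem_ofPred_eq, mem_union, mem_inter_iff, mem_preimage, or_and_right]
    refine or_congr (and_congr_right fun h => ?_) (and_congr_right fun h => ?_)
    · rw [hfX _ h, hv]
    · rw [hfY _ h, hv]
  obtain ⟨D, part, h1, h2, h3, h4, h5⟩ := H.fubini_image (hX.union hY) hf
  have him : f '' (X ∪ Y) = {(fun _ => c₀), fun _ => c₁} := by
    rw [image_union, insert_eq]
    congr 1
    · rw [Set.image_congr hfX]
      exact hXne.image_const (fun _ => c₀)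
    · rw [Set.image_congr hfY]
      exact hYne.image_const (fun _ => c₁)
  have hfib₀ : {x ∈ X ∪ Y | f x = fun _ => c₀} = X := by
    ext x
    constructor
    · rintro ⟨h | h, hx⟩
      · exact h
      · exact (hc' (hx.symm.trans (hfY x h))).elim
    · exact fun h => ⟨Or.inl h, hfX x h⟩
  have hfib₁ : {x ∈ X ∪ Y | f x = fun _ => c₁} = Y := by
    ext x
    constructor
    · rintro ⟨h | h, hx⟩
      · exact (hc' ((hfX x h).symm.trans hx)).elim
      · exact h
    · exact fun h => ⟨Or.inr h, hfY x h⟩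
  have hpart : ∀ p y, y ∈ part p ↔
      (y = (fun _ => c₀) ∧ p = (dim m X, meas m X)) ∨
      (y = (fun _ => c₁) ∧ p = (dim m Y, meas m Y)) := by
    intro p y
    rw [h1, him]
    simp only [mem_ofPred_eq, mem_insert_iff, mem_singleton_iff, or_and_right]
    refine or_congr (and_congr_right ?_) (and_congr_right ?_)
    · rintro rfl
      rw [hfib₀, Prod.ext_iff, eq_comm, eq_comm (a := meas m X)]
    · rintro rfl
      rw [hfib₁, Prod.ext_iff, eq_comm, eq_comm (a := meas m Y)]
  have hD : D = {(dim m X, meas m X), (dim m Y, meas m Y)} := by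
    ext p
    rw [Finset.mem_insert, Finset.mem_singleton]
    constructor
    · intro hp
      obtain ⟨y, hy⟩ := (h2 p hp).1
      exact ((hpart p y).1 hy).imp And.right And.right
    · rintro (rfl | rfl)
      · have := h3 (fun _ => c₀) (by simp [him])
        rwa [hfib₀] at this
      · have := h3 (fun _ => c₁) (by simp [him])
        rwa [hfib₁] at this
  subst hD
  -- When the two fibres have equal values, Fubini sees a single part with two points, and the sum
  -- arises as a multiple by 2.
  by_cases hp : (dim m X, meas m X) = (dim m Y, meas m Y)
  · have hpt : part (dim m Y, meas m Y) = {(fun _ => c₀), fun _ => c₁} := by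
      ext y
      rw [hpart, hp]
      simp
    obtain ⟨e1, e2⟩ := H.finite_sets 1 _ (toFinite {(fun _ : Fin 1 => c₀), fun _ => c₁})
    rw [ncard_pair hc'] at e2
    rw [hp, Finset.pair_eq_singleton, Finset.sup_singleton, hpt, e1, add_zero] at h4
    rw [hp, Finset.pair_eq_singleton, Finset.sum_filter, Finset.sum_singleton, hpt, e1, e2,
      add_zero, h4, if_pos rfl] at h5
    obtain ⟨hp1, hp2⟩ := Prod.ext_iff.1 hp
    dsimp only at hp1 hp2 h4 h5
    rw [h4, h5, hp1, hp2, max_self]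
    refine ⟨rfl, ?_⟩
    rw [if_pos rfl]
    push_cast
    ring
  · have hp0 : part (dim m X, meas m X) = {fun _ => c₀} := by
      ext y
      rw [hpart]
      simp [hp]
    have hp1 : part (dim m Y, meas m Y) = {fun _ => c₁} := by
      ext y
      rw [hpart]
      simp [Ne.symm hp]
    have e0 := H.finite_sets 1 {fun _ => c₀} (finite_singleton _)
    have e1 := H.finite_sets 1 {fun _ => c₁} (finite_singleton _)
    rw [Finset.sup_insert, Finset.sup_singleton, hp0, hp1, e0.1, e1.1] at h4
    have h4' : dim m (X ∪ Y) = max (dim m X) (dim m Y) := by simpa using h4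
    refine ⟨h4', ?_⟩
    rw [h5, Finset.sum_filter, Finset.sum_pair hp, hp0, hp1, e0.1, e1.1, e0.2, e1.2, h4']
    simp

section Dim

variable [Infinite M] (H : IsDimensionMeasure L M dim meas)
include H

theorem dim_mono {m : ℕ} {X Y : Set (Fin m → M)} (hX : (univ : Set M).Definable L X)
    (hY : (univ : Set M).Definable L Y) (h : X ⊆ Y) : dim m X ≤ dim m Y := by
  have := (H.union_of_disjoint hX (hY.sdiff hX) disjoint_sdiff_right).1
  rw [union_sdiff_cancel h] at this
  omega

theorem dim_union_le {m : ℕ} {X Y : Set (Fin m → M)} (hX : (univ : Set M).Definable L X)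
    (hY : (univ : Set M).Definable L Y) : dim m (X ∪ Y) ≤ max (dim m X) (dim m Y) := by
  have := (H.union_of_disjoint hX (hY.sdiff hX) disjoint_sdiff_right).1
  rw [union_sdiff_self] at this
  have h2 := H.dim_mono (hY.sdiff hX) hY sdiff_subset
  omega

theorem dim_biUnion_le {ι : Type*} {m : ℕ} (s : Finset ι) (X : ι → Set (Fin m → M))
    (hX : ∀ i ∈ s, (univ : Set M).Definable L (X i)) {d : ℕ} (hd : ∀ i ∈ s, dim m (X i) ≤ d) :
    (univ : Set M).Definable L (⋃ i ∈ s, X i) ∧ dim m (⋃ i ∈ s, X i) ≤ d := by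
  classical
  induction s using Finset.induction_on with
  | empty => simp [H.dim_empty, definable_empty]
  | insert i s hi ih =>
    obtain ⟨h1, h2⟩ := ih (fun i hi => hX i (Finset.mem_insert_of_mem hi))
      (fun i hi => hd i (Finset.mem_insert_of_mem hi))
    have hi1 := hX i (Finset.mem_insert_self i s)
    rw [Finset.set_biUnion_insert]
    exact ⟨hi1.union h1, (H.dim_union_le hi1 h1).trans
      (max_le (hd i (Finset.mem_insert_self i s)) h2)⟩

/-- The measure in dimension `d` is additive on sets of dimension at most `d`. -/
theorem meas_union_of_dim_le {m : ℕ} {X Y : Set (Fin m → M)}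
    (hX : (univ : Set M).Definable L X) (hY : (univ : Set M).Definable L Y) (hXY : Disjoint X Y)
    {d : ℕ} (hdX : dim m X ≤ d) (hdY : dim m Y ≤ d) :
    (if dim m (X ∪ Y) = d then meas m (X ∪ Y) else 0) =
      (if dim m X = d then meas m X else 0) + (if dim m Y = d then meas m Y else 0) := by
  obtain ⟨h1, h2⟩ := H.union_of_disjoint hX hY hXY
  rw [h1, h2]
  by_cases h : max (dim m X) (dim m Y) = d
  · rw [if_pos h, h]
  · rw [if_neg h, if_neg (by omega), if_neg (by omega), add_zero]

end Dim

/-! ### Fubini inequalities for sections of a relation -/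

section Projection

theorem definable_section {n m : ℕ} {W : Set (Fin n ⊕ Fin m → M)}
    (hW : (univ : Set M).Definable L W) (x : Fin n → M) :
    (univ : Set M).Definable L {y : Fin m → M | Sum.elim x y ∈ W} := by
  have h : (univ : Set M).Definable L (W ∩ ⋂ i ∈ (Finset.univ : Finset (Fin n)),
      {v : Fin n ⊕ Fin m → M | v (Sum.inl i) = x i}) :=
    hW.inter (definable_biInter_finset (fun i => definable_eq_const _ _) _)
  convert h.image_comp (Sum.inr : Fin m → Fin n ⊕ Fin m) using 1
  ext y
  constructor
  · intro hy
    exact ⟨Sum.elim x y, ⟨hy, by simp⟩, rfl⟩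
  · rintro ⟨v, ⟨hv, hx⟩, rfl⟩
    have : v ∘ Sum.inl = x := by simpa [funext_iff] using hx
    rw [← this]
    simpa using hv

variable (H : IsDimensionMeasure L M dim meas) {n m k : ℕ} (e : Fin n ⊕ Fin m ≃ Fin k)
  {W : Set (Fin n ⊕ Fin m → M)} (hW : (univ : Set M).Definable L W)
include H hW

/-- On a fibre of the first projection the remaining coordinates determine the point, so they give a
definable bijection onto the section. The bijection `e` reindexes `W` by a single `Fin k`, as `dim`
requires. -/
theorem fibre_eq_section (x : Fin n → M) :
    dim k {v ∈ {v : Fin k → M | v ∘ e ∈ W} | v ∘ (e ∘ Sum.inl) = x} =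
      dim m {y | Sum.elim x y ∈ W} := by
  have hW' : (univ : Set M).Definable L {v : Fin k → M | v ∘ e ∈ W} := hW.preimage_comp e
  have hF : (univ : Set M).Definable L
      {v ∈ {v : Fin k → M | v ∘ e ∈ W} | v ∘ (e ∘ Sum.inl) = x} := by
    convert hW'.inter (definable_biInter_finset
      (fun i => definable_eq_const (L := L) (e (Sum.inl i)) (x i)) Finset.univ) using 1
    ext v
    simp [funext_iff]
  rw [(H.image_of_injOn hF (definableGraphOn_comp hF (e ∘ Sum.inr)) ?_).1]
  · congr 1
    ext y
    constructor
    · rintro ⟨v, ⟨hv, rfl⟩, rfl⟩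
      change Sum.elim ((v ∘ e) ∘ Sum.inl) ((v ∘ e) ∘ Sum.inr) ∈ W
      rwa [Sum.elim_comp_inl_inr]
    · intro hy
      refine ⟨Sum.elim x y ∘ e.symm, ⟨?_, ?_⟩, ?_⟩
      · change (Sum.elim x y ∘ e.symm) ∘ e ∈ W
        simpa [Function.comp_assoc] using hy
      · ext i; simp
      · ext i; simp
  · rintro v ⟨-, hv⟩ v' ⟨-, hv'⟩ h
    funext i
    obtain ⟨i, rfl⟩ := e.surjective i
    rcases i with i | i
    · exact (congrFun hv i).trans (congrFun hv' i).symm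
    · exact congrFun h i

variable [Infinite M]

theorem dim_le_of_sections {d : ℕ} (hd : ∀ x, dim m {y | Sum.elim x y ∈ W} ≤ d) :
    dim k {v : Fin k → M | v ∘ e ∈ W} ≤
      d + dim n {x | ∃ y : Fin m → M, Sum.elim x y ∈ W} := by
  have hW' : (univ : Set M).Definable L {v : Fin k → M | v ∘ e ∈ W} := hW.preimage_comp e
  obtain ⟨D, part, h1, h2, h3, h4, h5⟩ :=
    H.fubini_image hW' (definableGraphOn_comp hW' (e ∘ Sum.inl))
  rw [h4]
  refine Finset.sup_le fun p hp => ?_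
  obtain ⟨⟨y, hy⟩, hdef⟩ := h2 p hp
  have hsub : part p ⊆ {x | ∃ y : Fin m → M, Sum.elim x y ∈ W} := by
    rw [h1]
    rintro _ ⟨⟨v, hv, rfl⟩, -⟩
    refine ⟨(v ∘ e) ∘ Sum.inr, ?_⟩
    change Sum.elim ((v ∘ e) ∘ Sum.inl) ((v ∘ e) ∘ Sum.inr) ∈ W
    rwa [Sum.elim_comp_inl_inr]
  rw [h1] at hy
  have h6 := hy.2.1
  rw [H.fibre_eq_section e hW] at h6
  exact add_le_add (h6 ▸ hd y) (H.dim_mono hdef hW.exists_of_finite hsub)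

/-- The points with section dimension at least `d` form a finite union of Fubini parts. One part has
the dimension of the union, and its term bounds the maximum from below. Nonemptiness is demanded
separately because the empty set also has dimension 0. -/
theorem le_dim_of_sections (d : ℕ) :
    (univ : Set M).Definable L
      {x | (∃ y : Fin m → M, Sum.elim x y ∈ W) ∧ d ≤ dim m {y | Sum.elim x y ∈ W}} ∧
    ((∃ x, (∃ y : Fin m → M, Sum.elim x y ∈ W) ∧ d ≤ dim m {y | Sum.elim x y ∈ W}) →
    d + dim n {x | (∃ y : Fin m → M, Sum.elim x y ∈ W) ∧ d ≤ dim m {y | Sum.elim x y ∈ W}} ≤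
      dim k {v : Fin k → M | v ∘ e ∈ W}) := by
  have hW' : (univ : Set M).Definable L {v : Fin k → M | v ∘ e ∈ W} := hW.preimage_comp e
  obtain ⟨D, part, h1, h2, h3, h4, h5⟩ :=
    H.fubini_image hW' (definableGraphOn_comp hW' (e ∘ Sum.inl))
  have him : (fun v => v ∘ (e ∘ Sum.inl)) '' {v : Fin k → M | v ∘ e ∈ W} =
      {x | ∃ y : Fin m → M, Sum.elim x y ∈ W} := by
    ext x
    constructor
    · rintro ⟨v, hv, rfl⟩
      refine ⟨(v ∘ e) ∘ Sum.inr, ?_⟩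
      change Sum.elim ((v ∘ e) ∘ Sum.inl) ((v ∘ e) ∘ Sum.inr) ∈ W
      rwa [Sum.elim_comp_inl_inr]
    · rintro ⟨y, hy⟩
      refine ⟨Sum.elim x y ∘ e.symm, ?_, ?_⟩
      · change (Sum.elim x y ∘ e.symm) ∘ e ∈ W
        simpa [Function.comp_assoc] using hy
      · ext i; simp
  have hZ : {x | (∃ y : Fin m → M, Sum.elim x y ∈ W) ∧ d ≤ dim m {y | Sum.elim x y ∈ W}} =
      ⋃ p ∈ D.filter (fun p => d ≤ p.1), part p := by
    ext x
    simp only [mem_iUnion, h1, him, H.fibre_eq_section e hW, Finset.mem_filter]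
    constructor
    · rintro ⟨hx, hd⟩
      have := h3 x (by rw [him]; exact hx)
      rw [H.fibre_eq_section e hW] at this
      exact ⟨_, ⟨this, hd⟩, hx, rfl, rfl⟩
    · rintro ⟨p, ⟨hp, hd⟩, hx, hp1, hp2⟩
      exact ⟨hx, hp1 ▸ hd⟩
  have hdef : ∀ p ∈ D.filter (fun p => d ≤ p.1), (univ : Set M).Definable L (part p) :=
    fun p hp => (h2 p (Finset.mem_filter.1 hp).1).2
  rw [hZ]
  refine ⟨(H.dim_biUnion_le _ part hdef fun p hp =>
      Finset.le_sup (f := fun p => dim n (part p)) hp).1,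
    fun hne => ?_⟩
  have hne' : (D.filter (fun p => d ≤ p.1)).Nonempty := by
    obtain ⟨x, hx⟩ := hne
    have hx' : x ∈ ⋃ p ∈ D.filter (fun p => d ≤ p.1), part p := hZ ▸ hx
    obtain ⟨p, hp, -⟩ := mem_iUnion₂.1 hx'
    exact ⟨p, hp⟩
  obtain ⟨p, hp, hmax⟩ := Finset.exists_max_image _ (fun p => dim n (part p)) hne'
  have hle := (H.dim_biUnion_le _ part hdef hmax).2
  rw [h4]
  refine (add_le_add (Finset.mem_filter.1 hp).2 hle).trans ?_
  exact Finset.le_sup (f := fun p => p.1 + dim n (part p)) (Finset.mem_filter.1 hp).1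

end Projection

omit [L.Structure M] in
theorem elim_comp_swap_mem {n m : ℕ} {W : Set (Fin n ⊕ Fin m → M)} (x : Fin n → M)
    (y : Fin m → M) :
    Sum.elim y x ∈ (fun v : Fin m ⊕ Fin n → M => v ∘ Sum.swap) ⁻¹' W ↔ Sum.elim x y ∈ W := by
  have : Sum.elim y x ∘ Sum.swap = Sum.elim x y := by
    funext i
    rcases i with i | i <;> rfl
  rw [mem_preimage, this]

theorem definable_section_right {n m : ℕ} {W : Set (Fin n ⊕ Fin m → M)}
    (hW : (univ : Set M).Definable L W) (y : Fin m → M) :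
    (univ : Set M).Definable L {x : Fin n → M | Sum.elim x y ∈ W} := by
  simpa only [elim_comp_swap_mem] using definable_section (hW.preimage_comp Sum.swap) y

omit [L.Structure M] in
theorem swap_total_eq {n m : ℕ} {W : Set (Fin n ⊕ Fin m → M)} :
    {v : Fin (n + m) → M | v ∘ ((Equiv.sumComm (Fin m) (Fin n)).trans finSumFinEquiv) ∈
      (fun v : Fin m ⊕ Fin n → M => v ∘ Sum.swap) ⁻¹' W} =
    {v : Fin (n + m) → M | v ∘ finSumFinEquiv ∈ W} := by
  ext v
  rw [mem_ofPred_eq, mem_ofPred_eq, mem_preimage]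
  have : (v ∘ ((Equiv.sumComm (Fin m) (Fin n)).trans finSumFinEquiv)) ∘ Sum.swap =
      v ∘ finSumFinEquiv := by
    funext i
    rcases i with i | i <;> rfl
  rw [this]

/-! ### The same inequalities with the two factors exchanged -/

section Bounds

variable [Infinite M] (H : IsDimensionMeasure L M dim meas) {n m : ℕ}
  {W : Set (Fin n ⊕ Fin m → M)} (hW : (univ : Set M).Definable L W)
include H hW

theorem dim_le_of_sections_right {d : ℕ}
    (hd : ∀ y : Fin m → M, dim n {x | Sum.elim x y ∈ W} ≤ d) :
    dim (n + m) {v : Fin (n + m) → M | v ∘ finSumFinEquiv ∈ W} ≤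
      d + dim m {y | ∃ x : Fin n → M, Sum.elim x y ∈ W} := by
  have := H.dim_le_of_sections ((Equiv.sumComm (Fin m) (Fin n)).trans finSumFinEquiv)
    (hW.preimage_comp Sum.swap) (d := d) (by simpa only [elim_comp_swap_mem] using hd)
  rw [swap_total_eq] at this
  simpa only [elim_comp_swap_mem] using this

theorem le_dim_of_sections_right (d : ℕ) :
    (univ : Set M).Definable L
      {y | (∃ x : Fin n → M, Sum.elim x y ∈ W) ∧ d ≤ dim n {x | Sum.elim x y ∈ W}} ∧
    ((∃ y, (∃ x : Fin n → M, Sum.elim x y ∈ W) ∧ d ≤ dim n {x | Sum.elim x y ∈ W}) →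
    d + dim m {y | (∃ x : Fin n → M, Sum.elim x y ∈ W) ∧ d ≤ dim n {x | Sum.elim x y ∈ W}} ≤
      dim (n + m) {v : Fin (n + m) → M | v ∘ finSumFinEquiv ∈ W}) := by
  have := H.le_dim_of_sections ((Equiv.sumComm (Fin m) (Fin n)).trans finSumFinEquiv)
    (hW.preimage_comp Sum.swap) d
  rw [swap_total_eq] at this
  simpa only [elim_comp_swap_mem] using this

end Bounds

/-! ### Double counting and the greedy inconsistent sequence -/

section Inconsistent

variable [Infinite M] (H : IsDimensionMeasure L M dim meas) {n m : ℕ}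
  {W : Set (Fin n ⊕ Fin m → M)} (hW : (univ : Set M).Definable L W)
  {P : Set (Fin n → M)} {Q : Set (Fin m → M)}
  (hP : (univ : Set M).Definable L P) (hQ : (univ : Set M).Definable L Q)
  (hWPQ : ∀ x y, Sum.elim x y ∈ W → x ∈ P ∧ y ∈ Q) {d : ℕ}
  (hWx : ∀ x ∈ P, (∃ y, Sum.elim x y ∈ W) ∧ dim m {y | Sum.elim x y ∈ W} = d)
include H hW hP hWPQ hWx

omit hP in
include hQ in
/-- If the sections `W_y` have dimension smaller than `P` then the sections `W_x` have dimension
smaller than `Q`. -/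
theorem dim_section_lt (hPne : P.Nonempty)
    (hWy : ∀ y ∈ Q, dim n {x | Sum.elim x y ∈ W} < dim n P) : d < dim m Q := by
  -- Fibring over `P` bounds dim `W` below by d + dim `P`; fibring over `Q` bounds it above by (dim
  -- `P` − 1) + dim `Q`. The subtraction is genuine, since a smaller dimension forces dim `P` > 0.
  have h1 : d + dim n P ≤ dim (n + m) {v : Fin (n + m) → M | v ∘ finSumFinEquiv ∈ W} := by
    have := (H.le_dim_of_sections finSumFinEquiv hW d).2
      (hPne.imp fun x hx => ⟨(hWx x hx).1, (hWx x hx).2.ge⟩)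
    convert this using 3
    ext x
    exact ⟨fun hx => ⟨(hWx x hx).1, (hWx x hx).2.ge⟩, fun ⟨⟨y, hy⟩, _⟩ => (hWPQ x y hy).1⟩
  obtain ⟨x, hx⟩ := hPne
  obtain ⟨y₀, hy₀⟩ := (hWx x hx).1
  have hpos : 0 < dim n P := (Nat.zero_le _).trans_lt (hWy y₀ (hWPQ x y₀ hy₀).2)
  have h2 : dim (n + m) {v : Fin (n + m) → M | v ∘ finSumFinEquiv ∈ W} ≤
      (dim n P - 1) + dim m {y | ∃ x : Fin n → M, Sum.elim x y ∈ W} := by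
    refine H.dim_le_of_sections_right hW fun y => ?_
    by_cases hy : y ∈ Q
    · have := hWy y hy
      omega
    · have : {x : Fin n → M | Sum.elim x y ∈ W} = ∅ :=
        eq_empty_of_forall_notMem fun x hx => hy (hWPQ x y hx).2
      simp [this, H.dim_empty]
  have h3 : dim m {y | ∃ x : Fin n → M, Sum.elim x y ∈ W} ≤ dim m Q := by
    refine H.dim_mono ?_ hQ fun y ⟨x, hx⟩ => (hWPQ x y hx).2
    simpa only [elim_comp_swap_mem] using
      (hW.preimage_comp Sum.swap).exists_of_finite
  omega

omit hP hWPQ in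
/-- The parameters `y` for which `W_y` does not cut down the dimension of `Y` form a set of
dimension at most `d`. -/
theorem dim_notDrop_le {Y : Set (Fin n → M)} (hY : (univ : Set M).Definable L Y) (hYP : Y ⊆ P) :
    (univ : Set M).Definable L
      {y | (∃ x ∈ Y, Sum.elim x y ∈ W) ∧ dim n Y ≤ dim n {x | x ∈ Y ∧ Sum.elim x y ∈ W}} ∧
    dim m {y | (∃ x ∈ Y, Sum.elim x y ∈ W) ∧ dim n Y ≤ dim n {x | x ∈ Y ∧ Sum.elim x y ∈ W}} ≤
      d := by
  -- Restrict `W` to `Y`: its dimension is at least dim `Y` plus that of the set in question, and at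
  -- most d + dim `Y`. Cancelling dim `Y` gives the bound.
  have hV : (univ : Set M).Definable L {v : Fin n ⊕ Fin m → M | v ∘ Sum.inl ∈ Y ∧ v ∈ W} :=
    (hY.preimage_comp Sum.inl).inter hW
  have hmem : ∀ (x : Fin n → M) (y : Fin m → M),
      Sum.elim x y ∈ {v : Fin n ⊕ Fin m → M | v ∘ Sum.inl ∈ Y ∧ v ∈ W} ↔
        x ∈ Y ∧ Sum.elim x y ∈ W := fun x y => Iff.rfl
  obtain ⟨h1, h2⟩ := H.le_dim_of_sections_right hV (dim n Y)
  simp only [hmem] at h1 h2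
  refine ⟨h1, ?_⟩
  by_cases hne : ∃ y, (∃ x ∈ Y, Sum.elim x y ∈ W) ∧ dim n Y ≤ dim n {x | x ∈ Y ∧ Sum.elim x y ∈ W}
  · have h3 : dim (n + m)
        {v | v ∘ finSumFinEquiv ∈ {v : Fin n ⊕ Fin m → M | v ∘ Sum.inl ∈ Y ∧ v ∈ W}} ≤
        d + dim n {x | ∃ y : Fin m → M, x ∈ Y ∧ Sum.elim x y ∈ W} := by
      refine H.dim_le_of_sections finSumFinEquiv hV fun x => ?_
      by_cases hx : x ∈ Y
      · simpa only [hmem, hx, true_and] using (hWx x (hYP hx)).2.le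
      · simp [hmem, hx, H.dim_empty]
    have h4 : {x | ∃ y : Fin m → M, x ∈ Y ∧ Sum.elim x y ∈ W} = Y := by
      ext x
      exact ⟨fun ⟨y, hy⟩ => hy.1, fun hx => (hWx x (hYP hx)).1.imp fun y hy => ⟨hx, hy⟩⟩
    rw [h4] at h3
    have := h2 hne
    omega
  · have : {y : Fin m → M | (∃ x ∈ Y, Sum.elim x y ∈ W) ∧
        dim n Y ≤ dim n {x | x ∈ Y ∧ Sum.elim x y ∈ W}} = ∅ :=
      eq_empty_of_forall_notMem fun y hy => hne ⟨y, hy⟩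
    rw [this, H.dim_empty]
    exact Nat.zero_le _

omit [Infinite M] H hWPQ hWx in
theorem definable_inter_sections (G : Finset (Fin m → M)) :
    (univ : Set M).Definable L {x | x ∈ P ∧ ∀ g ∈ G, Sum.elim x g ∈ W} := by
  convert hP.inter (definable_biInter_finset (fun g => definable_section_right hW g) G) using 1
  ext x
  simp

include hQ in
/-- A family of sets whose dimensions are smaller than that of `P` has an inconsistent
subsequence. -/
theorem exists_inconsistent_sequence (hPne : P.Nonempty)
    (hWy : ∀ y ∈ Q, dim n {x | Sum.elim x y ∈ W} < dim n P) :
    ∃ (k : ℕ) (s : ℕ → Fin m → M), (∀ i, s i ∈ Q) ∧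
      ∀ I : Finset ℕ, I.card = k → ¬ ∃ x : Fin n → M, ∀ i ∈ I, Sum.elim x (s i) ∈ W := by
  classical
  have hlt := H.dim_section_lt hW hQ hWPQ hWx hPne hWy
  let Y : Finset (Fin m → M) → Set (Fin n → M) := fun G => {x | x ∈ P ∧ ∀ g ∈ G, Sum.elim x g ∈ W}
  have hY : ∀ G, (univ : Set M).Definable L (Y G) := definable_inter_sections hW hP
  -- Parameters that empty `Y G` are not bad; this matters when `Y G` has dimension 0, where no
  -- further drop is possible.
  let Z : Finset (Fin m → M) → Set (Fin m → M) := fun G => {y | (∃ x ∈ Y G, Sum.elim x y ∈ W) ∧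
    dim n (Y G) ≤ dim n {x | x ∈ Y G ∧ Sum.elim x y ∈ W}}
  have hZ : ∀ G, (univ : Set M).Definable L (Z G) ∧ dim m (Z G) ≤ d := fun G =>
    H.dim_notDrop_le hW hWx (hY G) fun x hx => hx.1
  -- The finitely many bad sets have dimension at most `d`, which is less than dim `Q`, so they
  -- cannot cover `Q`.
  have hstep : ∀ F : Finset (Fin m → M), ∃ b ∈ Q, ∀ G ⊆ F, b ∉ Z G := by
    intro F
    by_contra! hcon
    have hsub : Q ⊆ ⋃ G ∈ F.powerset, Z G := fun b hb => by
      obtain ⟨G, hG, hbG⟩ := hcon b hb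
      exact mem_biUnion (Finset.mem_coe.2 (Finset.mem_powerset.2 hG)) hbG
    obtain ⟨h1, h2⟩ := H.dim_biUnion_le F.powerset Z (fun G _ => (hZ G).1) (fun G _ => (hZ G).2)
    have := H.dim_mono hQ h1 hsub
    omega
  choose g hgQ hg using hstep
  let F : ℕ → Finset (Fin m → M) := fun i => Nat.rec ∅ (fun _ F => insert (g F) F) i
  have hF : ∀ i, F (i + 1) = insert (g (F i)) (F i) := fun i => rfl
  have hFmono : Monotone F := monotone_nat_of_le_succ fun i => by
    rw [hF]
    exact Finset.subset_insert _ _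
  have hmem : ∀ i k, i < k → g (F i) ∈ F k := fun i k h =>
    hFmono (Nat.succ_le_of_lt h) (by rw [Nat.succ_eq_add_one, hF]; exact Finset.mem_insert_self _ _)
  have hdim : ∀ I : Finset ℕ, (Y (I.image fun i => g (F i))).Nonempty →
      dim n (Y (I.image fun i => g (F i))) + I.card ≤ dim n P := by
    intro I
    -- The largest index is added last: all the parameters of `J` were then available when its term
    -- was chosen.
    induction I using Finset.induction_on_max with
    | empty =>
      intro _
      simp [Y]
    | insert a J hJ ih =>
      rintro ⟨x, hx⟩
      have heq : Y ((insert a J).image fun i => g (F i)) =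
          {x | x ∈ Y (J.image fun i => g (F i)) ∧ Sum.elim x (g (F a)) ∈ W} := by
        ext x
        simp only [Y, Finset.image_insert, Finset.forall_mem_insert, mem_ofPred_eq]
        tauto
      have hna := hg (F a) (J.image fun i => g (F i)) (fun b hb => by
        obtain ⟨i, hi, rfl⟩ := Finset.mem_image.1 hb
        exact hmem i a (hJ i hi))
      rw [heq] at hx ⊢
      have h1 := ih ⟨x, hx.1⟩
      have h2 : ¬ dim n (Y (J.image fun i => g (F i))) ≤
          dim n {x | x ∈ Y (J.image fun i => g (F i)) ∧ Sum.elim x (g (F a)) ∈ W} :=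
        fun h => hna ⟨⟨x, hx⟩, h⟩
      rw [Finset.card_insert_of_notMem fun h => (hJ a h).false]
      omega
  -- Each consistent term costs one dimension, so at most dim `P` terms are consistent. The bound is
  -- also positive, so a common point lies in some section and hence in `P`.
  refine ⟨dim n P + 1, fun i => g (F i), fun i => hgQ _, ?_⟩
  rintro I hI ⟨x, hx⟩
  obtain ⟨i, hi⟩ := Finset.card_pos.1 (by omega : 0 < I.card)
  have := hdim I ⟨x, (hWPQ _ _ (hx i hi)).1, fun b hb => by
    obtain ⟨i, hi, rfl⟩ := Finset.mem_image.1 hb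
    exact hx i hi⟩
  omega

end Inconsistent

end IsDimensionMeasure

/-! ### Solution sets, types over a tuple and automorphisms -/

section Sol

variable {L : FirstOrder.Language.{u, v}} {M : Type w} {N : Type w'} [L.Structure M] [L.Structure N]
  {n : ℕ} {α : Type*}

/-- The solution set of `φ(x, b)`, for a parameter tuple `b` with an arbitrary index type. -/
def sol (φ : L.Formula (Fin n ⊕ α)) (b : α → M) : Set (Fin n → M) :=
  {x | φ.Realize (Sum.elim x b)}

theorem definable_sol (φ : L.Formula (Fin n ⊕ α)) (b : α → M) :
    (univ : Set M).Definable L (sol φ b) := by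
  rw [definable_iff_exists_formula_sum]
  refine ⟨φ.relabel (Sum.elim Sum.inr fun i => Sum.inl ⟨b i, mem_univ _⟩), ?_⟩
  ext x
  simp only [sol, mem_ofPred_eq, Formula.realize_relabel]
  refine iff_of_eq (congrArg φ.Realize ?_)
  funext i
  rcases i with i | i <;> rfl

theorem sol_relabel {β : Type*} (φ : L.Formula (Fin n ⊕ α)) (f : α → β) (b : β → M) :
    sol (φ.relabel (Sum.map id f)) b = sol φ (b ∘ f) := by
  ext x
  simp only [sol, mem_ofPred_eq, Formula.realize_relabel]
  refine iff_of_eq (congrArg φ.Realize ?_)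
  funext i
  rcases i with i | i <;> rfl

theorem sol_inf (φ ψ : L.Formula (Fin n ⊕ α)) (b : α → M) :
    sol (φ ⊓ ψ) b = sol φ b ∩ sol ψ b := by
  ext x
  simp [sol]

theorem sol_sup (φ ψ : L.Formula (Fin n ⊕ α)) (b : α → M) :
    sol (φ ⊔ ψ) b = sol φ b ∪ sol ψ b := by
  ext x
  simp [sol]

theorem sol_not (φ : L.Formula (Fin n ⊕ α)) (b : α → M) : sol φ.not b = (sol φ b)ᶜ := by
  ext x
  simp [sol]

theorem sol_top (b : α → M) : sol (⊤ : L.Formula (Fin n ⊕ α)) b = univ := by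
  ext x
  simp [sol]

theorem sol_iInf {ι : Type*} [Finite ι] (φ : ι → L.Formula (Fin n ⊕ α)) (b : α → M) :
    sol (Formula.iInf φ) b = ⋂ i, sol (φ i) b := by
  ext x
  simp [sol]

theorem sol_iSup {ι : Type*} [Finite ι] (φ : ι → L.Formula (Fin n ⊕ α)) (b : α → M) :
    sol (Formula.iSup φ) b = ⋃ i, sol (φ i) b := by
  ext x
  simp [sol]

theorem SameType.sol_nonempty_iff {b : α → M} {c : α → N} (h : SameType L b c)
    (φ : L.Formula (Fin n ⊕ α)) : (sol φ b).Nonempty ↔ (sol φ c).Nonempty := by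
  have := h ((φ.relabel Sum.swap).iExs (Fin n))
  simpa [Formula.realize_iExs, Formula.realize_relabel, Set.Nonempty, sol] using this

theorem SameType.sol_subset_iff {b : α → M} {c : α → N} (h : SameType L b c)
    (φ ψ : L.Formula (Fin n ⊕ α)) : sol φ b ⊆ sol ψ b ↔ sol φ c ⊆ sol ψ c := by
  have := h.sol_nonempty_iff (φ ⊓ ψ.not)
  rw [sol_inf, sol_not, sol_inf, sol_not] at this
  rw [← not_iff_not, not_subset, not_subset]
  exact this

theorem SameType.sol_eq_iff {b : α → M} {c : α → N} (h : SameType L b c)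
    (φ ψ : L.Formula (Fin n ⊕ α)) : sol φ b = sol ψ b ↔ sol φ c = sol ψ c := by
  rw [Subset.antisymm_iff, Subset.antisymm_iff, h.sol_subset_iff, h.sol_subset_iff]

theorem exists_solutionSet {X : Set (Fin n → M)} (hX : (univ : Set M).Definable L X) :
    ∃ (m : ℕ) (φ : L.Formula (Fin n ⊕ Fin m)) (b : Fin m → M), X = solutionSet φ b := by
  obtain ⟨A₀, -, hA₀⟩ := definable_iff_finitely_definable.1 hX
  obtain ⟨φ, rfl⟩ := definable_iff_exists_formula_sum.1 hA₀
  let e := A₀.equivFin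
  refine ⟨A₀.card, φ.relabel (Sum.elim (fun a => Sum.inr (e a)) Sum.inl), fun i => e.symm i, ?_⟩
  ext x
  simp only [solutionSet, mem_ofPred_eq, Formula.realize_relabel]
  refine iff_of_eq (congrArg φ.Realize ?_)
  funext i
  rcases i with i | i
  · exact congrArg Subtype.val (e.symm_apply_apply i).symm
  · rfl

theorem sameTypeOver_range_iff {r m : ℕ} (a : Fin r → M) (b c : Fin m → M) :
    SameTypeOver L (range a) b c ↔ SameType L (Sum.elim b a) (Sum.elim c a) := by
  constructor
  · intro h φ
    have hdef : (range a).Definable L {y : Fin m → M | φ.Realize (Sum.elim y a)} := by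
      rw [definable_iff_exists_formula_sum]
      refine ⟨φ.relabel (Sum.elim Sum.inr fun i => Sum.inl ⟨a i, mem_range_self i⟩), ?_⟩
      ext x
      simp only [mem_ofPred_eq, Formula.realize_relabel]
      refine iff_of_eq (congrArg φ.Realize ?_)
      funext i
      rcases i with i | i <;> rfl
    obtain ⟨ψ, hψ⟩ := hdef
    have : ∀ y : Fin m → M, φ.Realize (Sum.elim y a) ↔ ψ.Realize y := fun y => Set.ext_iff.1 hψ y
    rw [this, this]
    exact h ψ
  · intro h ψ
    obtain ⟨φ, hφ⟩ := definable_iff_exists_formula_sum.1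
      (⟨ψ, rfl⟩ : (range a).Definable L {y : Fin m → M | ψ.Realize y})
    have hs : ∀ x : range a, a x.2.choose = x := fun x => x.2.choose_spec
    have : ∀ y : Fin m → M, ψ.Realize y ↔
        (φ.relabel (Sum.elim (fun x => Sum.inr x.2.choose) Sum.inl)).Realize (Sum.elim y a) := by
      intro y
      rw [Formula.realize_relabel]
      refine (Set.ext_iff.1 hφ y).trans (iff_of_eq (congrArg φ.Realize ?_))
      funext i
      rcases i with i | i
      · exact (hs i).symm
      · rfl
    rw [this, this]
    exact h _

/-- In a strongly homogeneous structure, tuples of the same type over a finite set are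
conjugate. -/
theorem exists_automorphism {κ : Cardinal.{w}} (hκ : Cardinal.aleph0 ≤ κ)
    (hhom : IsStronglyHomogeneous L M κ) {α : Type*} [Finite α] {b c : α → M}
    (h : SameType L b c) : ∃ σ : M ≃[L] M, ∀ i, σ (b i) = c i := by
  have hs : ∀ x : range b, b x.2.choose = x := fun x => x.2.choose_spec
  obtain ⟨σ, hσ⟩ := hhom (range b) (fun x => c x.2.choose)
    ((Cardinal.lt_aleph0_of_finite _).trans_le hκ) (fun φ => by
      have := h (φ.relabel fun x => x.2.choose)
      rw [Formula.realize_relabel, Formula.realize_relabel] at this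
      have hb : b ∘ (fun x : range b => x.2.choose) = fun x : range b => (x : M) := funext hs
      rwa [hb] at this)
  refine ⟨σ, fun i => (hσ ⟨b i, mem_range_self i⟩).trans ?_⟩
  -- The map was defined through a chosen index of each value of `b`; equal entries of `b` give
  -- equal entries of `c`, as equality is part of the type.
  have := h ((Term.var (Exists.choose (mem_range_self i : b i ∈ range b))).equal (Term.var i))
  simp only [Formula.realize_equal, Term.realize_var] at this
  exact this.1 (hs ⟨b i, mem_range_self i⟩)

end Sol

/-! ### Dimension and measure in terms of types -/

namespace IsDimensionMeasure

variable {L : FirstOrder.Language.{u, v}} {M : Type w} [L.Structure M]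
  {dim : ∀ n : ℕ, Set (Fin n → M) → ℕ} {meas : ∀ n : ℕ, Set (Fin n → M) → ℝ}
  (H : IsDimensionMeasure L M dim meas) {n : ℕ} {α : Type*} [Finite α]
include H

/-- Each value of h is taken on a ∅-definable set of parameters, which cannot separate tuples of the
same type. -/
theorem sameType_eq (φ : L.Formula (Fin n ⊕ α)) {b c : α → M} (h : SameType L b c) :
    dim n (sol φ b) = dim n (sol φ c) ∧ meas n (sol φ b) = meas n (sol φ c) := by
  obtain ⟨k, ⟨e⟩⟩ := Finite.exists_equiv_fin α
  have hsol : ∀ b : α → M, solutionSet (φ.relabel (Sum.map id e)) (b ∘ e.symm) = sol φ b := by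
    intro b
    refine (sol_relabel φ e (b ∘ e.symm)).trans ?_
    simp [Function.comp_assoc]
  obtain ⟨ψ, hψ⟩ := empty_definable_iff.1 (H.definable n k (φ.relabel (Sum.map id e))
    (dim n (sol φ c)) (meas n (sol φ c)))
  have hiff : ∀ b : α → M, (dim n (sol φ b) = dim n (sol φ c) ∧ meas n (sol φ b) = meas n (sol φ c))
      ↔ ψ.Realize (b ∘ e.symm) := by
    intro b
    have := Set.ext_iff.1 hψ (b ∘ e.symm)
    rw [mem_ofPred_eq, hsol] at this
    exact this
  rw [hiff, h.comp e.symm ψ, ← hiff]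
  exact ⟨rfl, rfl⟩

/-- Only finitely many measures occur in dimension `d`, so a finite disjunction over them forgets
the measure. -/
theorem exists_formula_dim (φ : L.Formula (Fin n ⊕ α)) (d : ℕ) :
    ∃ π : L.Formula α, ∀ b : α → M, π.Realize b ↔ dim n (sol φ b) = d := by
  classical
  obtain ⟨k, ⟨e⟩⟩ := Finite.exists_equiv_fin α
  have hsol : ∀ b : α → M, solutionSet (φ.relabel (Sum.map id e)) (b ∘ e.symm) = sol φ b := by
    intro b
    refine (sol_relabel φ e (b ∘ e.symm)).trans ?_
    simp [Function.comp_assoc]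
  have hfin := H.finite_values n k (φ.relabel (Sum.map id e))
  have hdef : (∅ : Set M).Definable L (⋃ p ∈ hfin.toFinset.filter fun p => p.1 = d,
      {b : Fin k → M | dim n (solutionSet (φ.relabel (Sum.map id e)) b) = p.1 ∧
        meas n (solutionSet (φ.relabel (Sum.map id e)) b) = p.2}) :=
    definable_biUnion_finset (fun p : ℕ × ℝ => H.definable n k (φ.relabel (Sum.map id e)) p.1 p.2) _
  obtain ⟨ψ, hψ⟩ := empty_definable_iff.1 hdef
  refine ⟨ψ.relabel e.symm, fun b => ?_⟩
  rw [Formula.realize_relabel]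
  refine (Set.ext_iff.1 hψ (b ∘ e.symm)).symm.trans ?_
  simp only [mem_iUnion, Finset.mem_filter, Finite.mem_toFinset, mem_ofPred_eq, hsol]
  constructor
  · rintro ⟨p, ⟨-, hp⟩, h1, -⟩
    exact h1.trans hp
  · intro h
    exact ⟨(dim n (sol φ b), meas n (sol φ b)), ⟨⟨b ∘ e.symm, by simp only [hsol]⟩, h⟩, rfl, rfl⟩

end IsDimensionMeasure

/-! ### From a drop in dimension to dividing -/

section Dividing

variable {L : FirstOrder.Language.{u, v}} {M : Type w} [L.Structure M]
  {dim : ∀ n : ℕ, Set (Fin n → M) → ℕ} {meas : ∀ n : ℕ, Set (Fin n → M) → ℝ}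

/-- If a formula over `a b` cuts down the dimension of a set `P` over `a` on which the dual
dimension is constant, then it divides over `a`. -/
theorem IsDimensionMeasure.exists_inconsistent_sameType [Infinite M]
    (H : IsDimensionMeasure L M dim meas) {n m r : ℕ} (a : Fin r → M) (b : Fin m → M)
    (Θ : L.Formula (Fin m ⊕ Fin r))
    (hΘ' : ∀ y : Fin m → M, Θ.Realize (Sum.elim y a) → SameType L (Sum.elim y a) (Sum.elim b a))
    (φ : L.Formula (Fin n ⊕ Fin m)) (π : L.Formula (Fin n ⊕ Fin r)) (d : ℕ)
    (hπ : ∀ x ∈ sol π a, (∃ y, y ∈ sol Θ a ∧ x ∈ sol φ y) ∧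
      dim m {y | y ∈ sol Θ a ∧ x ∈ sol φ y} = d)
    (hne : (sol π a).Nonempty) (hlt : dim n (sol φ b ∩ sol π a) < dim n (sol π a)) :
    ∃ (k : ℕ) (s : ℕ → Fin m → M), (∀ i, SameType L (Sum.elim (s i) a) (Sum.elim b a)) ∧
      ∀ I : Finset ℕ, I.card = k → ¬ ∃ x : Fin n → M, ∀ i ∈ I, x ∈ sol φ (s i) ∩ sol π a := by
  let W : Set (Fin n ⊕ Fin m → M) :=
    ((fun v => v ∘ Sum.inr) ⁻¹' sol Θ a) ∩
      (Set.ofPred φ.Realize ∩ (fun v => v ∘ Sum.inl) ⁻¹' sol π a)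
  have hW : (univ : Set M).Definable L W :=
    ((definable_sol Θ a).preimage_comp Sum.inr).inter
      (((empty_definable_iff.2 ⟨φ, rfl⟩).mono (empty_subset _)).inter
        ((definable_sol π a).preimage_comp Sum.inl))
  have hmem : ∀ x y, Sum.elim x y ∈ W ↔ y ∈ sol Θ a ∧ x ∈ sol φ y ∧ x ∈ sol π a :=
    fun x y => Iff.rfl
  have hsec : ∀ y : Fin m → M, sol φ y ∩ sol π a =
      sol (φ.relabel (Sum.map id Sum.inl) ⊓ π.relabel (Sum.map id Sum.inr)) (Sum.elim y a) := by
    intro y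
    rw [sol_inf, sol_relabel, sol_relabel, Sum.elim_comp_inl, Sum.elim_comp_inr]
  obtain ⟨k, s, hs, hk⟩ := H.exists_inconsistent_sequence hW (definable_sol π a)
    (definable_sol Θ a) (fun x y h => ⟨h.2.2, h.1⟩) (d := d)
    (fun x hx => by simpa only [hmem, hx, and_true] using hπ x hx) hne
    (fun y hy => by
      have h1 : {x | Sum.elim x y ∈ W} = sol φ y ∩ sol π a := by
        ext x
        rw [mem_ofPred_eq, hmem]
        exact and_iff_right hy
      rw [h1, hsec, (H.sameType_eq _ (hΘ' y hy)).1, ← hsec]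
      -- The drop assumed at `b` holds at every `y` in `sol Θ a`, since these all have the type of
      -- `b` over `a`.
      exact hlt)
  refine ⟨k, s, fun i => hΘ' _ (hs i), fun I hI ⟨x, hx⟩ => hk I hI ⟨x, fun i hi => ?_⟩⟩
  exact ⟨hs i, hx i hi⟩

end Dividing

/-! ### Invariant Keisler measures induced from `M` -/

section Trace

variable {L : FirstOrder.Language.{u, v}} [Countable L.Symbols] {M : Type w} {N : Type w'}
  [L.Structure M] [L.Structure N] {n r : ℕ}

/-- `Y ⊆ M ^ n` is defined by a formula `φ(x, b')` and `X ⊆ N ^ n` by `φ(x, b)`, where `b'` and `b`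
have the same type over `a`. -/
def IsTrace (j : M ↪ₑ[L] N) (a : Fin r → M) (X : Set (Fin n → N)) (Y : Set (Fin n → M)) : Prop :=
  ∃ (m : ℕ) (φ : L.Formula (Fin n ⊕ Fin m)) (b : Fin m → N) (b' : Fin m → M),
    SameType L (Sum.elim b fun i => j (a i)) (Sum.elim b' a) ∧
      X = solutionSet φ b ∧ Y = solutionSet φ b'

variable (hM : IsOmegaCategorical L M) (j : M ↪ₑ[L] N) (a : Fin r → M)

include hM in
theorem exists_isTrace {X : Set (Fin n → N)} (hX : (univ : Set N).Definable L X) :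
    ∃ Y, IsTrace j a X Y := by
  obtain ⟨m, φ, b, rfl⟩ := exists_solutionSet hX
  obtain ⟨b', hb'⟩ := hM.exists_sameType j a b
  exact ⟨_, m, φ, b, b', hb', rfl, rfl⟩

omit [Countable L.Symbols] in
variable {j a} in
theorem IsTrace.definable {X : Set (Fin n → N)} {Y : Set (Fin n → M)} (h : IsTrace j a X Y) :
    (univ : Set M).Definable L Y := by
  obtain ⟨m, φ, b, b', hb', rfl, rfl⟩ := h
  exact definable_solutionSet _ _

variable {dim : ∀ n : ℕ, Set (Fin n → M) → ℕ} {meas : ∀ n : ℕ, Set (Fin n → M) → ℝ}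

include hM in
variable {j a} in
-- Two presentations of `X` have parameters `b` and `c`; copying them jointly into `M` preserves the
-- equality of the sets they define. Each separate copy agrees in type over `a` with its half of the
-- joint copy, so h agrees. This makes the induced measure independent of choices.
theorem IsTrace.unique (H : IsDimensionMeasure L M dim meas) (π : L.Formula (Fin n ⊕ Fin r))
    {X : Set (Fin n → N)} {Y Y' : Set (Fin n → M)} (h : IsTrace j a X Y) (h' : IsTrace j a X Y') :
    dim n (Y ∩ sol π a) = dim n (Y' ∩ sol π a) ∧ meas n (Y ∩ sol π a) = meas n (Y' ∩ sol π a) := by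
  obtain ⟨m, φ, b, b', hb', hX, rfl⟩ := h
  obtain ⟨k, ψ, c, c', hc', hX', rfl⟩ := h'
  obtain ⟨e, he⟩ := hM.exists_sameType j a (Sum.elim b c)
  have hbe : SameType L (Sum.elim b' a) (Sum.elim (e ∘ Sum.inl) a) := by
    refine hb'.symm.trans ?_
    have := he.comp (Sum.elim (Sum.inl ∘ Sum.inl) Sum.inr : Fin m ⊕ Fin r → (Fin m ⊕ Fin k) ⊕ Fin r)
    convert this using 1 <;> (funext i; rcases i with i | i <;> rfl)
  have hce : SameType L (Sum.elim c' a) (Sum.elim (e ∘ Sum.inr) a) := by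
    refine hc'.symm.trans ?_
    have := he.comp (Sum.elim (Sum.inl ∘ Sum.inr) Sum.inr : Fin k ⊕ Fin r → (Fin m ⊕ Fin k) ⊕ Fin r)
    convert this using 1 <;> (funext i; rcases i with i | i <;> rfl)
  have heq : sol φ (e ∘ Sum.inl) = sol ψ (e ∘ Sum.inr) := by
    have := (he.comp Sum.inl).sol_eq_iff (φ.relabel (Sum.map id Sum.inl))
      (ψ.relabel (Sum.map id Sum.inr))
    simp only [sol_relabel, Sum.elim_comp_inl, Sum.elim_comp_inr] at this
    exact this.1 (hX.symm.trans hX')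
  have hinter : ∀ {l : ℕ} (χ : L.Formula (Fin n ⊕ Fin l)) (y : Fin l → M), sol χ y ∩ sol π a =
      sol (χ.relabel (Sum.map id Sum.inl) ⊓ π.relabel (Sum.map id Sum.inr)) (Sum.elim y a) := by
    intro l χ y
    rw [sol_inf, sol_relabel, sol_relabel, Sum.elim_comp_inl, Sum.elim_comp_inr]
  have h1 := H.sameType_eq (φ.relabel (Sum.map id Sum.inl) ⊓ π.relabel (Sum.map id Sum.inr)) hbe
  have h2 := H.sameType_eq (ψ.relabel (Sum.map id Sum.inl) ⊓ π.relabel (Sum.map id Sum.inr)) hce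
  rw [← hinter, ← hinter] at h1 h2
  rw [heq] at h1
  exact ⟨h1.1.trans h2.1.symm, h1.2.trans h2.2.symm⟩

include hM in
theorem exists_isTrace_pair {X₁ X₂ : Set (Fin n → N)} (hX₁ : (univ : Set N).Definable L X₁)
    (hX₂ : (univ : Set N).Definable L X₂) :
    ∃ Y₁ Y₂, IsTrace j a X₁ Y₁ ∧ IsTrace j a X₂ Y₂ ∧ IsTrace j a (X₁ ∪ X₂) (Y₁ ∪ Y₂) ∧
      (Disjoint X₁ X₂ → Disjoint Y₁ Y₂) := by
  obtain ⟨m, φ, b, rfl⟩ := exists_solutionSet hX₁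
  obtain ⟨k, ψ, c, rfl⟩ := exists_solutionSet hX₂
  let d : Fin (m + k) → N := Sum.elim b c ∘ finSumFinEquiv.symm
  let φ' : L.Formula (Fin n ⊕ Fin (m + k)) := φ.relabel (Sum.map id (finSumFinEquiv ∘ Sum.inl))
  let ψ' : L.Formula (Fin n ⊕ Fin (m + k)) := ψ.relabel (Sum.map id (finSumFinEquiv ∘ Sum.inr))
  have hφ : solutionSet φ b = solutionSet φ' d := by
    refine Eq.trans ?_ (sol_relabel φ (finSumFinEquiv ∘ Sum.inl) d).symm
    refine congrArg (solutionSet φ) ?_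
    funext i
    simp [d]
  have hψ : solutionSet ψ c = solutionSet ψ' d := by
    refine Eq.trans ?_ (sol_relabel ψ (finSumFinEquiv ∘ Sum.inr) d).symm
    refine congrArg (solutionSet ψ) ?_
    funext i
    simp [d]
  obtain ⟨d', hd'⟩ := hM.exists_sameType j a d
  refine ⟨solutionSet φ' d', solutionSet ψ' d', ⟨_, φ', d, d', hd', hφ, rfl⟩,
    ⟨_, ψ', d, d', hd', hψ, rfl⟩, ⟨_, φ' ⊔ ψ', d, d', hd', ?_, ?_⟩, ?_⟩
  · rw [hφ, hψ]
    exact (sol_sup φ' ψ' d).symm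
  · exact (sol_sup φ' ψ' d').symm
  · rw [hφ, hψ]
    intro h
    have := (hd'.comp Sum.inl).sol_subset_iff φ' ψ'.not
    rw [sol_not, sol_not, subset_compl_iff_disjoint_right, subset_compl_iff_disjoint_right] at this
    exact this.1 h

/-- The part of the normalized measure of `Z` in the dimension of `P`. -/
noncomputable def relMeas (dim : ∀ n : ℕ, Set (Fin n → M) → ℕ)
    (meas : ∀ n : ℕ, Set (Fin n → M) → ℝ) (P Z : Set (Fin n → M)) : ℝ :=
  (if dim n Z = dim n P then meas n Z else 0) / meas n P

/-- A nonempty set `P` that is definable over `a` induces a Keisler measure, invariant over `a`,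
given by the relative measure within `P` in the dimension of `P`. -/
theorem exists_keislerMeasure (H : IsDimensionMeasure L M dim meas)
    (π : L.Formula (Fin n ⊕ Fin r)) (hP : (sol π a).Nonempty) (hM : IsOmegaCategorical L M) :
    ∃ μ : Def L N n → ℝ, IsKeislerMeasure μ ∧ IsInvariantOver (range fun i => j (a i)) μ ∧
      ∀ (X : Def L N n) (Y : Set (Fin n → M)), IsTrace j a (X : Set (Fin n → N)) Y →
        μ X = relMeas dim meas (sol π a) (Y ∩ sol π a) := by
  have : Infinite M := hM.2.1
  have hPdef := definable_sol π a
  have hpos := H.pos n _ hPdef hP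
  choose Y hY using fun X : Def L N n => exists_isTrace hM j a X.2
  let μ : Def L N n → ℝ := fun X => relMeas dim meas (sol π a) (Y X ∩ sol π a)
  have hμ : ∀ (X : Def L N n) (Y : Set (Fin n → M)), IsTrace j a (X : Set (Fin n → N)) Y →
      μ X = relMeas dim meas (sol π a) (Y ∩ sol π a) := by
    intro X Y' hY'
    obtain ⟨h1, h2⟩ := (hY X).unique hM H π hY'
    simp only [μ, relMeas, h1, h2]
  refine ⟨μ, ⟨fun X => ?_, ?_, fun X₁ X₂ hX => ?_⟩, ?_, hμ⟩
  · refine div_nonneg ?_ hpos.le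
    split_ifs
    · rcases (Y X ∩ sol π a).eq_empty_or_nonempty with h | h
      · rw [h, H.meas_empty]
      · exact (H.pos n _ ((hY X).definable.inter hPdef) h).le
    · exact le_rfl
  · have htop : IsTrace j a ((⊤ : Def L N n) : Set (Fin n → N)) (univ : Set (Fin n → M)) := by
      obtain ⟨b', hb'⟩ := hM.exists_sameType j a (Fin.elim0 : Fin 0 → N)
      exact ⟨0, ⊤, Fin.elim0, b', hb', (sol_top _).symm, (sol_top _).symm⟩
    rw [hμ _ _ htop, univ_inter, relMeas, if_pos rfl, div_self hpos.ne']
  · obtain ⟨Y₁, Y₂, h1, h2, h3, h4⟩ := exists_isTrace_pair hM j a X₁.2 X₂.2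
    have hdisj : Disjoint (X₁ : Set (Fin n → N)) X₂ := by
      rw [Set.disjoint_iff_inter_eq_empty, ← DefinableSet.coe_inf, hX.eq_bot, DefinableSet.coe_bot]
    have h3' : IsTrace j a ((X₁ ⊔ X₂ : Def L N n) : Set (Fin n → N)) (Y₁ ∪ Y₂) := by
      rw [DefinableSet.coe_sup]
      exact h3
    rw [hμ _ _ h1, hμ _ _ h2, hμ _ _ h3']
    have d1 := h1.definable.inter hPdef
    have d2 := h2.definable.inter hPdef
    have := H.meas_union_of_dim_le d1 d2 ((h4 hdisj).mono inter_subset_left inter_subset_left)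
      (H.dim_mono d1 hPdef inter_subset_right) (H.dim_mono d2 hPdef inter_subset_right)
    rw [← union_inter_distrib_right] at this
    rw [relMeas, this, add_div]
    rfl
  -- Since `σ` fixes `a`, the tuples `b` and `σ b` can share the copy `b'` in `M`.
  · intro σ hσ m φ b
    obtain ⟨b', hb'⟩ := hM.exists_sameType j a b
    have hσb : SameType L (Sum.elim (fun i => σ (b i)) fun i => j (a i)) (Sum.elim b' a) := by
      refine SameType.trans ?_ hb'
      convert sameType_equiv σ (Sum.elim b fun i => j (a i)) using 1
      funext i
      rcases i with i | i
      · rfl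
      · exact (hσ _ (mem_range_self i)).symm
    rw [hμ _ _ ⟨m, φ, _, b', hσb, rfl, rfl⟩, hμ _ _ ⟨m, φ, b, b', hb', rfl, rfl⟩]

end Trace

/-! ### Forking formulas are universally null -/

section KeislerMeasure

/-- A finitely additive measure on a Boolean algebra gives total mass at most `k` times that of `Y`
to elements of which no `k` meet within `Y`. -/
theorem sum_measure_le {B : Type*} [BooleanAlgebra B] {μ : B → ℝ} (hμ : ∀ X, 0 ≤ μ X)
    (hadd : ∀ X Y, Disjoint X Y → μ (X ⊔ Y) = μ X + μ Y) {ι : Type*} (X : ι → B) (k : ℕ) :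
    ∀ (s : Finset ι) (Y : B), (∀ I ⊆ s, I.card = k → I.inf X ⊓ Y = ⊥) →
      ∑ i ∈ s, μ (X i ⊓ Y) ≤ k * μ Y := by
  classical
  have hbot : μ ⊥ = 0 := by
    have := hadd ⊥ ⊥ disjoint_bot_left
    rw [bot_sup_eq] at this
    linarith
  have hsplit : ∀ Z Y, μ Y = μ (Y ⊓ Z) + μ (Y \ Z) := fun Z Y => by
    rw [← hadd _ _ disjoint_inf_sdiff, sup_inf_sdiff]
  induction k with
  | zero =>
    intro s Y h
    have hY : Y = ⊥ := by simpa using h ∅ (Finset.empty_subset s) rfl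
    simp [hY, hbot]
  | succ k ihk =>
    intro s
    induction s using Finset.induction_on with
    | empty =>
      intro Y _
      have := hμ Y
      simp only [Finset.sum_empty]
      positivity
    | insert i s hi ihs =>
      intro Y h
      -- Cut `Y` by `X i`: inside it no `k` of the other sets meet, so induction on `k` applies;
      -- outside it no `k + 1` meet, so induction on `s` applies.
      have h1 := ihk s (Y ⊓ X i) (fun I hI hcard => by
        have := h (insert i I) (Finset.insert_subset_insert i hI)
          (by rw [Finset.card_insert_of_notMem fun h => hi (hI h), hcard])
        rw [Finset.inf_insert] at this
        rw [← this]
        ac_rfl)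
      have h2 := ihs (Y \ X i) (fun I hI hcard => by
        have := h I (hI.trans (Finset.subset_insert i s)) hcard
        exact eq_bot_mono (inf_le_inf_left _ sdiff_le) this)
      have h3 : ∑ l ∈ s, μ (X l ⊓ Y) =
          ∑ l ∈ s, μ (X l ⊓ (Y ⊓ X i)) + ∑ l ∈ s, μ (X l ⊓ (Y \ X i)) := by
        rw [← Finset.sum_add_distrib]
        refine Finset.sum_congr rfl fun l _ => ?_
        rw [hsplit (X i) (X l ⊓ Y), inf_assoc, inf_sdiff_assoc]
      rw [Finset.sum_insert hi, h3, hsplit (X i) Y, inf_comm (X i) Y]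
      push_cast at h1 h2 ⊢
      nlinarith [hμ (Y \ X i)]

variable {L : FirstOrder.Language.{u, v}} {N : Type w} [L.Structure N] {n : ℕ}

theorem IsKeislerMeasure.map_bot {μ : Def L N n → ℝ} (hμ : IsKeislerMeasure μ) : μ ⊥ = 0 := by
  have := hμ.map_sup ⊥ ⊥ disjoint_bot_left
  rw [bot_sup_eq] at this
  linarith

theorem IsKeislerMeasure.mono {μ : Def L N n → ℝ} (hμ : IsKeislerMeasure μ) {X Y : Def L N n}
    (h : X ≤ Y) : μ X ≤ μ Y := by
  have := hμ.map_sup X (Y \ X) disjoint_sdiff_self_right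
  rw [sup_sdiff_cancel_right h] at this
  linarith [hμ.nonneg (Y \ X)]

theorem IsKeislerMeasure.sup_le {μ : Def L N n → ℝ} (hμ : IsKeislerMeasure μ) (X Y : Def L N n) :
    μ (X ⊔ Y) ≤ μ X + μ Y := by
  have := hμ.map_sup X (Y \ X) disjoint_sdiff_self_right
  rw [sup_sdiff_self_right] at this
  linarith [hμ.mono (sdiff_le : Y \ X ≤ Y)]

theorem IsKeislerMeasure.finset_sup_eq_zero {μ : Def L N n → ℝ} (hμ : IsKeislerMeasure μ)
    {ι : Type*} (s : Finset ι) (X : ι → Def L N n) (h : ∀ i ∈ s, μ (X i) = 0) :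
    μ (s.sup X) = 0 := by
  classical
  induction s using Finset.induction_on with
  | empty => simpa using hμ.map_bot
  | insert i s hi ih =>
    rw [Finset.sup_insert]
    have h1 := hμ.sup_le (X i) (s.sup X)
    rw [h i (Finset.mem_insert_self i s), ih fun i hi => h i (Finset.mem_insert_of_mem hi)] at h1
    linarith [hμ.nonneg (X i ⊔ s.sup X)]

theorem mem_finset_inf_iff {ι : Type*} (s : Finset ι) (X : ι → Def L N n) (x : Fin n → N) :
    x ∈ s.inf X ↔ ∀ i ∈ s, x ∈ X i := by
  classical
  induction s using Finset.induction_on with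
  | empty => simp
  | insert i s hi ih => simp [Finset.inf_insert, ih]

theorem mem_finset_sup_iff {ι : Type*} (s : Finset ι) (X : ι → Def L N n) (x : Fin n → N) :
    x ∈ s.sup X ↔ ∃ i ∈ s, x ∈ X i := by
  classical
  induction s using Finset.induction_on with
  | empty => simp
  | insert i s hi ih => simp [Finset.sup_insert, ih]

/-- A formula that divides over a finite tuple is null for each invariant Keisler measure. -/
theorem measure_eq_zero_of_divides {κ : Cardinal.{w}} (hκ : Cardinal.aleph0 ≤ κ)
    (hhom : IsStronglyHomogeneous L N κ) {r m : ℕ} (a : Fin r → N) (φ : L.Formula (Fin n ⊕ Fin m))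
    (b : Fin m → N) (hdiv : Divides (range a) φ b) {μ : Def L N n → ℝ} (hμ : IsKeislerMeasure μ)
    (hinv : IsInvariantOver (range a) μ) : μ (formulaClass φ b) = 0 := by
  obtain ⟨k, s, hs, hk⟩ := hdiv
  have heq : ∀ i, μ (formulaClass φ (s i)) = μ (formulaClass φ b) := by
    intro i
    obtain ⟨σ, hσ⟩ := exists_automorphism hκ hhom ((sameTypeOver_range_iff a _ _).1 (hs i)).symm
    have h1 : (fun l => σ (b l)) = s i := funext fun l => hσ (Sum.inl l)
    have := hinv σ (by rintro _ ⟨l, rfl⟩; exact hσ (Sum.inr l)) m φ b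
    rwa [h1] at this
  have hle : ∀ l : ℕ, l * μ (formulaClass φ b) ≤ k := by
    intro l
    have := sum_measure_le hμ.nonneg hμ.map_sup (fun i => formulaClass φ (s i)) k
      (Finset.range l) ⊤ (fun I _ hI => by
        rw [inf_top_eq, eq_bot_iff, DefinableSet.le_iff]
        intro x hx
        exact (hk I hI ⟨x, (mem_finset_inf_iff I _ x).1 hx⟩).elim)
    simpa [heq, hμ.map_top] using this
  by_contra hne
  have hpos : 0 < μ (formulaClass φ b) := (hμ.nonneg _).lt_of_ne' hne
  obtain ⟨l, hl⟩ := exists_nat_gt ((k : ℝ) / μ (formulaClass φ b))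
  rw [div_lt_iff₀ hpos] at hl
  exact (hle l).not_gt hl

theorem forkingIdeal_subset {κ : Cardinal.{w}} (hκ : Cardinal.aleph0 ≤ κ)
    (hhom : IsStronglyHomogeneous L N κ) {r : ℕ} (a : Fin r → N) :
    forkingIdeal L (range a) n ⊆ universallyNullIdeal L (range a) n := by
  rintro X ⟨k, m, ψ, c, hdiv, hX⟩ μ hμ hinv
  have h0 := hμ.finset_sup_eq_zero Finset.univ (fun i => formulaClass (ψ i) (c i))
    fun i _ => measure_eq_zero_of_divides hκ hhom a (ψ i) (c i) (hdiv i) hμ hinv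
  refine le_antisymm (h0 ▸ hμ.mono ?_) (hμ.nonneg X)
  rw [DefinableSet.le_iff]
  intro x hx
  obtain ⟨i, hi⟩ := mem_iUnion.1 (hX hx)
  exact (mem_finset_sup_iff _ _ x).2 ⟨i, Finset.mem_univ i, hi⟩

end KeislerMeasure

/-! ### Universally null formulas fork -/

section Forking

variable {L : FirstOrder.Language.{u, v}} {M : Type w} {N : Type w'} [L.Structure M] [L.Structure N]
  {n r : ℕ}

/-- Dividing over `a` of `φ(x, b') ∧ π(x, a)`, witnessed in `M`, gives dividing of
`φ(x, b) ∧ π(x, a)` in an elementary extension for each `b` of the same type over `a` as `b'`. -/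
theorem divides_of_inconsistent (j : M ↪ₑ[L] N) (a : Fin r → M) {m : ℕ} (b : Fin m → N)
    (b' : Fin m → M) (hb' : SameType L (Sum.elim b fun i => j (a i)) (Sum.elim b' a))
    (χ : L.Formula (Fin n ⊕ (Fin m ⊕ Fin r))) (k : ℕ) (s : ℕ → Fin m → M)
    (hs : ∀ i, SameType L (Sum.elim (s i) a) (Sum.elim b' a))
    (hk : ∀ I : Finset ℕ, I.card = k → ¬ ∃ x : Fin n → M, ∀ i ∈ I, x ∈ sol χ (Sum.elim (s i) a)) :
    Divides (range fun i => j (a i)) (χ.relabel (Sum.map id finSumFinEquiv))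
      (Sum.elim b (fun i => j (a i)) ∘ finSumFinEquiv.symm) := by
  -- Gathering the whole sequence into one tuple lets elementarity transfer the inconsistency of any
  -- finite part at once.
  let t : ℕ × (Fin m ⊕ Fin r) → M := fun p => Sum.elim (s p.1) a p.2
  have ht : ∀ i, (fun p => j (t p)) ∘ Prod.mk i = Sum.elim (fun l => j (s i l)) fun l => j (a l) :=
    fun i => by
      funext l
      rcases l with l | l <;> rfl
  have hsol : ∀ e : Fin m ⊕ Fin r → N,
      solutionSet (χ.relabel (Sum.map id finSumFinEquiv)) (e ∘ finSumFinEquiv.symm) = sol χ e := by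
    intro e
    refine (sol_relabel χ finSumFinEquiv (e ∘ finSumFinEquiv.symm)).trans ?_
    simp [Function.comp_assoc]
  refine ⟨k, fun i => Sum.elim (fun l => j (s i l)) (fun l => j (a l)) ∘ finSumFinEquiv.symm,
    fun i => ?_, fun I hI hx => ?_⟩
  · rw [sameTypeOver_range_iff]
    have h1 : SameType L (Sum.elim (fun l => j (s i l)) fun l => j (a l)) (Sum.elim (s i) a) := by
      rw [← ht]
      exact (sameType_elementaryEmbedding j t).comp (Prod.mk i)
    have h2 := ((h1.trans (hs i)).trans hb'.symm).comp
      (Sum.elim finSumFinEquiv.symm Sum.inr : Fin (m + r) ⊕ Fin r → Fin m ⊕ Fin r)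
    convert h2 using 1 <;> (funext l; rcases l with l | l <;> rfl)
  · have h1 := (sameType_elementaryEmbedding j t).sol_nonempty_iff
      (Formula.iInf fun i : I => χ.relabel (Sum.map id (Prod.mk (i : ℕ))))
    simp only [sol_iInf, sol_relabel, ht] at h1
    obtain ⟨x, hx⟩ := hx
    simp only [hsol] at hx
    obtain ⟨y, hy⟩ := h1.1 ⟨x, mem_iInter.2 fun i => hx i i.2⟩
    exact hk I hI ⟨y, fun i hi => mem_iInter.1 hy ⟨i, hi⟩⟩

theorem universallyNullIdeal_subset [Countable L.Symbols] (hM : IsOmegaCategorical L M)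
    (hMS : IsMSMeasurable L M) (j : M ↪ₑ[L] N) (a : Fin r → M) :
    universallyNullIdeal L (range fun i => j (a i)) n ⊆
      forkingIdeal L (range fun i => j (a i)) n := by
  intro X hX
  obtain ⟨_, dim, meas, H⟩ := hMS
  obtain ⟨m, φ, b, hφ⟩ := exists_solutionSet X.2
  obtain ⟨b', hb'⟩ := hM.exists_sameType j a b
  obtain ⟨Θ, hΘ, hΘ'⟩ := hM.isIsolated_of_finite (Sum.elim b' a)
  -- `Ψ` is the dual formula: it defines, over `x` and `a`, the conjugates `y` of `b'` with φ(x, y).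
  -- The formula `π d` then says that this set is nonempty of dimension `d`.
  let Ψ : L.Formula (Fin m ⊕ (Fin n ⊕ Fin r)) :=
    Θ.relabel (Sum.map id Sum.inr) ⊓ φ.relabel (Sum.elim (Sum.inr ∘ Sum.inl) Sum.inl)
  have hΨ : ∀ x : Fin n → M, sol Ψ (Sum.elim x a) = {y | y ∈ sol Θ a ∧ x ∈ sol φ y} := by
    intro x
    rw [sol_inf, sol_relabel, Sum.elim_comp_inr]
    ext y
    refine and_congr_right fun _ => ?_
    simp only [sol, mem_ofPred_eq, Formula.realize_relabel]
    refine iff_of_eq (congrArg φ.Realize ?_)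
    funext i
    rcases i with i | i <;> rfl
  choose δ hδ using fun d => H.exists_formula_dim Ψ d
  let π : ℕ → L.Formula (Fin n ⊕ Fin r) := fun d => (Ψ.relabel Sum.swap).iExs (Fin m) ⊓ δ d
  have hπ : ∀ d x, x ∈ sol (π d) a ↔ (∃ y, y ∈ sol Θ a ∧ x ∈ sol φ y) ∧
      dim m {y | y ∈ sol Θ a ∧ x ∈ sol φ y} = d := by
    intro d x
    rw [sol_inf, ← hΨ, ← hδ]
    refine and_congr_left fun _ => ?_
    change Formula.Realize _ _ ↔ _
    rw [Formula.realize_iExs]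
    refine exists_congr fun y => ?_
    have : y ∈ sol Θ a ∧ x ∈ sol φ y ↔ y ∈ sol Ψ (Sum.elim x a) := by rw [hΨ]; rfl
    rw [this, Formula.realize_relabel]
    simp [sol]
  let χ : ℕ → L.Formula (Fin n ⊕ (Fin m ⊕ Fin r)) := fun d =>
    φ.relabel (Sum.map id Sum.inl) ⊓ (π d).relabel (Sum.map id Sum.inr)
  have hχ : ∀ d (y : Fin m → M), sol (χ d) (Sum.elim y a) = sol φ y ∩ sol (π d) a := by
    intro d y
    rw [sol_inf, sol_relabel, sol_relabel, Sum.elim_comp_inl, Sum.elim_comp_inr]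
  have hdiv : ∀ d, ∃ (k : ℕ) (s : ℕ → Fin m → M),
      (∀ i, SameType L (Sum.elim (s i) a) (Sum.elim b' a)) ∧
      ∀ I : Finset ℕ, I.card = k → ¬ ∃ x : Fin n → M, ∀ i ∈ I, x ∈ sol φ (s i) ∩ sol (π d) a := by
    intro d
    rcases (sol φ b' ∩ sol (π d) a).eq_empty_or_nonempty with hemp | hne
    -- An empty piece divides along the constant sequence with k = 1.
    · refine ⟨1, fun _ => b', fun _ _ => Iff.rfl, fun I hI ⟨x, hx⟩ => ?_⟩
      obtain ⟨i, hi⟩ := Finset.card_pos.1 (hI ▸ Nat.one_pos)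
      exact (hemp ▸ hx i hi : x ∈ (∅ : Set (Fin n → M)))
    · have hPne := hne.mono inter_subset_right
      refine H.exists_inconsistent_sameType a b' Θ (fun y hy => hΘ' _ hy) φ (π d) d
        (fun x hx => (hπ d x).1 hx) hPne ?_
      have hPdef := definable_sol (π d) a
      have hidef := (definable_sol φ b').inter hPdef
      -- With no drop in dimension, the measure induced by `π d` would be positive on `X`, contrary
      -- to nullity.
      refine (H.dim_mono hidef hPdef inter_subset_right).lt_of_ne fun heq => ?_
      obtain ⟨μ, hμ, hinv, hval⟩ := exists_keislerMeasure j a H (π d) hPne hM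
      have h0 := hX μ hμ hinv
      rw [hval X (solutionSet φ b') ⟨m, φ, b, b', hb', hφ, rfl⟩] at h0
      have hpos := div_pos (H.pos n _ hidef hne) (H.pos n _ hPdef hPne)
      refine hpos.ne' ?_
      rw [relMeas] at h0
      exact (congrArg (· / meas n (sol (π d) a)) (if_pos heq).symm).trans h0
  choose k s hs hk using hdiv
  -- The dual sets lie in `sol Θ a`, so d runs from 0 to its dimension. Each disjunct carries `a`
  -- among its parameters, on account of `π d`.
  refine ⟨dim m (sol Θ a) + 1, fun _ => m + r,
    fun d => (χ d).relabel (Sum.map id finSumFinEquiv),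
    fun _ => Sum.elim b (fun i => j (a i)) ∘ finSumFinEquiv.symm, fun d => ?_, ?_⟩
  · exact divides_of_inconsistent j a b b' hb' (χ d) (k d) (s d) (hs d)
      (by simpa only [hχ] using hk d)
  -- The covering is checked in `M` at `b'`, where `b'` itself makes every dual set nonempty, and is
  -- transferred to `b` by equality of types.
  · have hcover := (hb'.sol_subset_iff (φ.relabel (Sum.map id Sum.inl))
      (Formula.iSup fun d : Fin (dim m (sol Θ a) + 1) => χ d)).2 (by
        rw [sol_relabel, sol_iSup, Sum.elim_comp_inl]
        intro x hx
        have hle : dim m {y | y ∈ sol Θ a ∧ x ∈ sol φ y} ≤ dim m (sol Θ a) :=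
          H.dim_mono (hΨ x ▸ definable_sol Ψ _) (definable_sol Θ a) fun y hy => hy.1
        refine mem_iUnion.2 ⟨⟨_, Nat.lt_succ_of_le hle⟩, ?_⟩
        rw [hχ]
        exact ⟨hx, (hπ _ x).2 ⟨⟨b', hΘ, hx⟩, rfl⟩⟩)
    rw [sol_relabel, sol_iSup, Sum.elim_comp_inl] at hcover
    intro x hx
    obtain ⟨d, hd⟩ := mem_iUnion.1 (hcover ((Set.ext_iff.1 hφ x).1 hx))
    refine mem_iUnion.2 ⟨d, ?_⟩
    change x ∈ sol _ _
    rw [sol_relabel]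
    simpa [Function.comp_assoc] using hd

end Forking

end MSForking

theorem lemma4p6 {L : FirstOrder.Language.{u, v}} [Countable L.Symbols]
    {M : Type w} [L.Structure M]
    (hcat : MSForking.IsOmegaCategorical L M) (hMS : MSForking.IsMSMeasurable L M)
    {𝕄 : Type w'} [L.Structure 𝕄] (j : M ↪ₑ[L] 𝕄)
    (κ : Cardinal.{w'}) (hκ : Cardinal.aleph0 ≤ κ)
    (hsat : MSForking.IsSaturated L 𝕄 κ) (hhom : MSForking.IsStronglyHomogeneous L 𝕄 κ)
    (A : Set M) (hA : A.Finite) (n : ℕ) :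
    MSForking.forkingIdeal L (j '' A) n = MSForking.universallyNullIdeal L (j '' A) n := by
  obtain ⟨r, a, -, rfl⟩ := hA.fin_param
  rw [← Set.range_comp]
  exact Set.Subset.antisymm (MSForking.forkingIdeal_subset hκ hhom _)
    (MSForking.universallyNullIdeal_subset hcat hMS j a)
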